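/- Let $n\ge 2$, $s\ge 1$, $0<\varepsilon<1$, $1\le p\le n$ and $q\ge s(n-1)+1-p+\varepsilon$, and let $C_J, D$ be real numbers. There is a constant $C>0$, depending only on $n,p,q,s,\varepsilon,C_J,D$, such that the following holds. Let $\Omega\subset\mathbb R^n$ be a bounded domain of diameter $D$ that is $s$-John with constant $C_J$ and center $x_0\in\Omega$: every $x\in\Omega$ can be joined to $x_0$ by a rectifiable curve $\gamma:[0,1]\to\Omega$ with $\gamma(0)=x$, $\gamma(1)=x_0$ and $$C_J\,d(\gamma(t),\partial\Omega)\ \ge\ \ell(\gamma([0,t]))^s\qquad\text{for all }0<t\le 1 .$$ Let $\mathbb W$ be any Whitney decomposition of $\Omega$, that is, a collection of closed cubes with edges parallel to the coordinate axes and pairwise disjoint interiors, with $\Omega=\bigcup_{Q\in\mathbb W}Q$, $\operatorname{diam} Q\in\{2^{-j}:j\in\mathbb Z\}$ and $\operatorname{diam} Q\le\operatorname{dist}(Q,\partial\Omega)\le 4\operatorname{diam} Q$ for all $Q\in\mathbb W$; and let $Q_0\in\mathbb W$ be a (central) cube containing $x_0$. Then for every compact set $E\subset\Omega$ disjoint from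 $Q_0$, $$\operatorname{cap}_p(E,Q_0,\Omega)\ \ge\ C\,\bigl(\mathcal H^q_\infty(E)\bigr)^{\frac{s(n-1)+1-p+\varepsilon}{q}} .$$ Here $\operatorname{cap}_p(E,Q_0,\Omega)=\inf_u\int_\Omega|\nabla u|^p\,dx$, the infimum being over all continuous $u\in W^{1,p}_{\mathrm{loc}}(\Omega)$ with $u\le 0$ on $E$ and $u\ge 1$ on $Q_0$ (with $\nabla u$ the weak gradient), and $\mathcal H^q_\infty(E)=\inf\sum_i r_i^q$, the infimum being over all countable coverings of $E$ by balls $B(x_i,r_i)$. -/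

import Mathlib

open MeasureTheory
open scoped ENNReal NNReal ContDiff

/-- `γ`, restricted to `[0,1]`, is a rectifiable curve in `Ω` from `x` to `x₀` which satisfies
`C * d(γ(t), ∂Ω) ≥ l(γ([0,t]))^s` for all `0 < t ≤ 1`. -/
structure IsSJohnCurve {X : Type*} [PseudoMetricSpace X]
    (s C : ℝ) (Ω : Set X) (x x₀ : X) (γ : ℝ → X) : Prop where
  continuousOn : ContinuousOn γ (Set.Icc 0 1)
  mapsTo : Set.MapsTo γ (Set.Icc 0 1) Ω
  source : γ 0 = x
  target : γ 1 = x₀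
  rectifiable : eVariationOn γ (Set.Icc 0 1) ≠ ⊤
  twisted : ∀ t ∈ Set.Ioc (0 : ℝ) 1,
    (eVariationOn γ (Set.Icc 0 t)).toReal ^ s ≤ C * Metric.infDist (γ t) (frontier Ω)

/-- `Ω` is a bounded domain which is `s`-John with constant `C` and John center `x₀`. -/
structure IsSJohnDomain {n : ℕ} (s C : ℝ) (Ω : Set (EuclideanSpace ℝ (Fin n)))
    (x₀ : EuclideanSpace ℝ (Fin n)) : Prop where
  isOpen : IsOpen Ω
  isConnected : IsConnected Ω
  isBounded : Bornology.IsBounded Ω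
  center_mem : x₀ ∈ Ω
  exists_curve : ∀ x ∈ Ω, ∃ γ : ℝ → EuclideanSpace ℝ (Fin n), IsSJohnCurve s C Ω x x₀ γ

/-- Closed (nondegenerate) cubes with edges parallel to the coordinate axes. -/
def IsClosedCube {n : ℕ} (Q : Set (EuclideanSpace ℝ (Fin n))) : Prop :=
  ∃ (a : EuclideanSpace ℝ (Fin n)) (l : ℝ), 0 < l ∧ Q = {x | ∀ i, x i ∈ Set.Icc (a i) (a i + l)}

/-- The distance `inf {d(x, y) : x ∈ A, y ∈ B}` between two (nonempty) sets. -/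
noncomputable def setDist {X : Type*} [PseudoMetricSpace X] (A B : Set X) : ℝ :=
  sInf (Set.image2 dist A B)

/-- `W` is a Whitney decomposition of `Ω`. -/
structure IsWhitneyDecomposition {n : ℕ} (Ω : Set (EuclideanSpace ℝ (Fin n)))
    (W : Set (Set (EuclideanSpace ℝ (Fin n)))) : Prop where
  isClosedCube : ∀ Q ∈ W, IsClosedCube Q
  disjoint_interior : ∀ Q ∈ W, ∀ Q' ∈ W, Q ≠ Q' → Disjoint (interior Q) (interior Q')
  sUnion_eq : ⋃₀ W = Ω
  diam_eq : ∀ Q ∈ W, ∃ j : ℤ, Metric.diam Q = (2 : ℝ) ^ (-j)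
  diam_le : ∀ Q ∈ W, Metric.diam Q ≤ setDist Q (frontier Ω)
  le_diam : ∀ Q ∈ W, setDist Q (frontier Ω) ≤ 4 * Metric.diam Q

/-- The Hausdorff `q`-content (for `q > 0`): the infimum of `∑ rᵢ^q` over all countable coverings
of `E` by balls `B(xᵢ, rᵢ)`. A ball of radius `0` is empty, so finite coverings are included. -/
noncomputable def hausdorffContent {X : Type*} [PseudoMetricSpace X] (q : ℝ) (E : Set X) : ℝ≥0∞ :=
  ⨅ (x : ℕ → X) (r : ℕ → ℝ≥0) (_ : E ⊆ ⋃ i, Metric.ball (x i) (r i)), ∑' i, (r i : ℝ≥0∞) ^ q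

/-- `u ∈ W^{1,p}_loc(Ω)` with weak gradient `g`: both `u` and `g` are `p`-integrable on the compact
subsets of `Ω`, and `∫ u ∂_v φ = - ∫ ⟨g, v⟩ φ` for all `φ ∈ C_c^∞(Ω)` and all directions `v`. -/
structure IsSobolevLocWith {n : ℕ} (p : ℝ) (Ω : Set (EuclideanSpace ℝ (Fin n)))
    (u : EuclideanSpace ℝ (Fin n) → ℝ)
    (g : EuclideanSpace ℝ (Fin n) → EuclideanSpace ℝ (Fin n)) : Prop where
  memLp_fun : ∀ K ⊆ Ω, IsCompact K → MemLp u (ENNReal.ofReal p) (volume.restrict K)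
  memLp_grad : ∀ K ⊆ Ω, IsCompact K → MemLp g (ENNReal.ofReal p) (volume.restrict K)
  integral_eq : ∀ φ : EuclideanSpace ℝ (Fin n) → ℝ,
    ContDiff ℝ ∞ φ → HasCompactSupport φ → tsupport φ ⊆ Ω →
    ∀ v : EuclideanSpace ℝ (Fin n),
      ∫ x in Ω, u x * fderiv ℝ φ x v = - ∫ x in Ω, inner ℝ (g x) v * φ x

/-- The `p`-capacity `cap_p(E, F, Ω)`: the infimum of `∫_Ω |∇u|^p` over all continuous
`u ∈ W^{1,p}_loc(Ω)` with `u ≤ 0` on `E` and `u ≥ 1` on `F`. -/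
noncomputable def pCapacity {n : ℕ} (p : ℝ) (E F Ω : Set (EuclideanSpace ℝ (Fin n))) : ℝ≥0∞ :=
  ⨅ (u : EuclideanSpace ℝ (Fin n) → ℝ) (g : EuclideanSpace ℝ (Fin n) → EuclideanSpace ℝ (Fin n))
    (_ : ContinuousOn u Ω ∧ IsSobolevLocWith p Ω u g ∧ (∀ x ∈ E, u x ≤ 0) ∧ ∀ x ∈ F, 1 ≤ u x),
    ∫⁻ x in Ω, ‖g x‖ₑ ^ p

/-! Let `ν` be the measure with density `|∇u|^p` on `Ω`, and put `α = s(n-1)+1-p+ε`. The heart of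
the matter is that every `x ∈ E` is the center of a ball of radius `r ≤ R` with `ν(B(x,r)) ≥ δ r^α`,
where `δ` and `R` depend on the data only (`exists_energy_lower_bound`). A Vitali covering and the
subadditivity of `t ↦ t^(α/q)` turn this into the bound by Hausdorff content
(`hausdorffContent_rpow_le_measure_univ`).

To find such a ball, suppose that `ν(B(x,r)) < δ r^α` for all `r ≤ R` and compare averages of `u`:
over balls shrinking to `x`, where they tend to `u x ≤ 0`; over a chain of balls following the John
curve, with radii 1/8 of the distance to the boundary; and inside the central cube, ending at a ball
on which `u ≥ 1`. Each comparison costs at most a constant times `δ^(1/p)`, so a small `δ` makes the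
total less than 1, a contradiction.

The chain is the essential part (`sum_chain_layer_le`). Consider its balls at arc length about `m`
from `x`. Their radii `r_i` add up to at most a multiple of `m`, the John condition makes each `r_i`
at least a multiple of `m^s`, and by bounded overlap their energies add up to at most a multiple of
`δ m^α`. Hölder's inequality with weights `r_i` bounds `∑ r_i^(1-n/p) ν(B_i)^(1/p)` by a multiple of
`m^(1-1/p) (m^(s(1-n)) δ m^α)^(1/p) = δ^(1/p) m^(ε/p)`. Since `ε > 0`, this is summable over dyadic
`m`.

Averages are taken against a smooth kernel, which makes the Poincaré inequality unnecessary: when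
center and radius move linearly, the kernel obeys a continuity equation, so the derivative of the
average is the integral of `∇u` against an explicit field
(`IsSobolevLocWith.hasDerivAt_smoothAverage`). -/

/-! ### A scaled smooth kernel -/

/-- A smooth nonnegative function of integral `1` supported in the unit ball. -/
noncomputable def unitKernel (n : ℕ) : EuclideanSpace ℝ (Fin n) → ℝ :=
  ContDiffBump.normed (⟨1 / 2, 1, by norm_num, by norm_num⟩ :
    ContDiffBump (0 : EuclideanSpace ℝ (Fin n))) volume

/-- The rescaling of `unitKernel` to the ball of center `y` and radius `r`. -/
noncomputable def scaledKernel {n : ℕ} (y : EuclideanSpace ℝ (Fin n)) (r : ℝ)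
    (w : EuclideanSpace ℝ (Fin n)) : ℝ :=
  (r ^ n)⁻¹ * unitKernel n (r⁻¹ • (w - y))

lemma contDiff_unitKernel (n : ℕ) : ContDiff ℝ ∞ (unitKernel n) :=
  ContDiffBump.contDiff_normed (n := ⊤) _

lemma unitKernel_nonneg (n : ℕ) (w : EuclideanSpace ℝ (Fin n)) : 0 ≤ unitKernel n w :=
  ContDiffBump.nonneg_normed _ _

lemma integral_unitKernel (n : ℕ) : ∫ w, unitKernel n w = 1 :=
  ContDiffBump.integral_normed _

lemma tsupport_unitKernel (n : ℕ) : tsupport (unitKernel n) = Metric.closedBall 0 1 :=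
  ContDiffBump.tsupport_normed_eq _

lemma hasCompactSupport_unitKernel (n : ℕ) : HasCompactSupport (unitKernel n) := by
  rw [HasCompactSupport, tsupport_unitKernel]; exact isCompact_closedBall _ _

/-- The unit kernel and its derivative are bounded. -/
lemma exists_bound_unitKernel (n : ℕ) :
    ∃ M : ℝ, 0 < M ∧ (∀ w, unitKernel n w ≤ M) ∧ ∀ w, ‖fderiv ℝ (unitKernel n) w‖ ≤ M := by
  obtain ⟨A, hA⟩ := (contDiff_unitKernel n).continuous.bounded_above_of_compact_support
    (hasCompactSupport_unitKernel n)
  obtain ⟨B, hB⟩ := ((contDiff_unitKernel n).continuous_fderiv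
    (by simp)).bounded_above_of_compact_support ((hasCompactSupport_unitKernel n).fderiv ℝ)
  refine ⟨max (max A B) 1, by positivity, fun w => ?_, fun w => ?_⟩
  · exact (le_abs_self _).trans ((hA w).trans (by simp))
  · exact (hB w).trans (by simp)

lemma unitKernel_eq_zero {n : ℕ} {w : EuclideanSpace ℝ (Fin n)} (hw : 1 < ‖w‖) :
    unitKernel n w = 0 := by
  apply image_eq_zero_of_notMem_tsupport
  rw [tsupport_unitKernel]; simpa using hw

lemma fderiv_unitKernel_eq_zero {n : ℕ} {w : EuclideanSpace ℝ (Fin n)} (hw : 1 < ‖w‖) :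
    fderiv ℝ (unitKernel n) w = 0 := by
  by_contra h
  have := support_fderiv_subset ℝ h
  rw [tsupport_unitKernel] at this
  simp at this; linarith

section scaledKernel

variable {n : ℕ} {y w : EuclideanSpace ℝ (Fin n)} {r : ℝ}

lemma one_lt_norm_inv_smul_sub (hr : 0 < r) (hw : w ∉ Metric.closedBall y r) :
    1 < ‖r⁻¹ • (w - y)‖ := by
  rw [Metric.mem_closedBall, dist_eq_norm, not_le] at hw
  rw [norm_smul, norm_inv, Real.norm_of_nonneg hr.le, inv_mul_eq_div, one_lt_div hr]
  exact hw

lemma scaledKernel_eq_zero (hr : 0 < r) (hw : w ∉ Metric.closedBall y r) :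
    scaledKernel y r w = 0 := by
  rw [scaledKernel, unitKernel_eq_zero (one_lt_norm_inv_smul_sub hr hw), mul_zero]

lemma contDiff_scaledKernel : ContDiff ℝ ∞ (scaledKernel y r) := by
  unfold scaledKernel
  have h : ContDiff ℝ ∞ fun w : EuclideanSpace ℝ (Fin n) => r⁻¹ • (w - y) := by fun_prop
  exact contDiff_const.mul ((contDiff_unitKernel n).comp h)

lemma scaledKernel_nonneg (hr : 0 < r) : 0 ≤ scaledKernel y r w :=
  mul_nonneg (by positivity) (unitKernel_nonneg _ _)

lemma scaledKernel_le {a M : ℝ} (ha : 0 < a) (har : a ≤ r) (hM : ∀ w, unitKernel n w ≤ M) :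
    scaledKernel y r w ≤ (a ^ n)⁻¹ * M := by
  have hr := ha.trans_le har
  have hM0 : 0 ≤ M := (unitKernel_nonneg n 0).trans (hM 0)
  exact mul_le_mul (by gcongr) (hM _) (unitKernel_nonneg _ _) (by positivity)

lemma integral_scaledKernel (hr : 0 < r) : ∫ w, scaledKernel y r w = 1 := by
  unfold scaledKernel
  rw [integral_const_mul,
    integral_sub_right_eq_self (fun w : EuclideanSpace ℝ (Fin n) => unitKernel n (r⁻¹ • w)) y,
    Measure.integral_comp_inv_smul, integral_unitKernel]
  simp [abs_of_pos (pow_pos hr n), (pow_pos hr n).ne']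

lemma hasFDerivAt_scaledKernel :
    HasFDerivAt (scaledKernel y r)
      (((r ^ n)⁻¹ * r⁻¹) • fderiv ℝ (unitKernel n) (r⁻¹ • (w - y))) w := by
  unfold scaledKernel
  have h1 : HasFDerivAt (fun w : EuclideanSpace ℝ (Fin n) => r⁻¹ • (w - y))
      (r⁻¹ • ContinuousLinearMap.id ℝ _) w :=
    ((hasFDerivAt_id w).sub_const y).fun_const_smul _
  have h2 := (((contDiff_unitKernel n).differentiable (by simp)) (r⁻¹ • (w - y))).hasFDerivAt
  refine ((h2.comp w h1).const_mul ((r ^ n)⁻¹)).congr_fderiv ?_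
  ext v
  simp [mul_assoc]

/-- The derivative of the scaled kernel along a segment in the upper half-space. -/
lemma hasDerivAt_scaledKernel (y v w : EuclideanSpace ℝ (Fin n)) (r ρ t : ℝ)
    (hr : 0 < r + t * ρ) :
    HasDerivAt (fun t => scaledKernel (y + t • v) (r + t * ρ) w)
      (-(fderiv ℝ (scaledKernel (y + t • v) (r + t * ρ)) w
          (v + (ρ / (r + t * ρ)) • (w - (y + t • v)))
        + n * (ρ / (r + t * ρ)) * scaledKernel (y + t • v) (r + t * ρ) w)) t := by
  -- The value is minus the divergence in `w` of the kernel times the field `v + (ρ / r) (w - y)`,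
  -- with `y` and `r` the current center and radius: this field transports the moving balls, and the
  -- kernel has constant mass.
  unfold scaledKernel
  have hR : HasDerivAt (fun t => r + t * ρ) ρ t := by
    simpa using ((hasDerivAt_id t).mul_const ρ).const_add r
  have hY : HasDerivAt (fun t => w - (y + t • v)) (-v) t := by
    simpa using (((hasDerivAt_id t).smul_const v).const_add y).const_sub w
  have hξ : HasDerivAt (fun t => (r + t * ρ)⁻¹ • (w - (y + t • v))) _ t := (hR.inv hr.ne').smul hY
  have h2 := (((contDiff_unitKernel n).differentiable (by simp))
    ((r + t * ρ)⁻¹ • (w - (y + t • v)))).hasFDerivAt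
  have h3 := h2.comp_hasDerivAt t hξ
  have h4 := ((hR.pow n).inv (pow_pos hr n).ne').mul h3
  refine HasDerivAt.congr_deriv (f := fun t => ((r + t * ρ) ^ n)⁻¹ *
    unitKernel n ((r + t * ρ)⁻¹ • (w - (y + t • v)))) h4 ?_
  have h5 := (hasFDerivAt_scaledKernel (y := y + t • v) (w := w) (r := r + t * ρ)).fderiv
  unfold scaledKernel at h5
  rw [h5]
  have hr' := hr.ne'
  simp only [smul_apply, map_add, map_smul, map_neg, smul_eq_mul, Function.comp,
    smul_neg]
  set A := fderiv ℝ (unitKernel n) ((r + t * ρ)⁻¹ • (w - (y + t • v))) v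
  set B := fderiv ℝ (unitKernel n) ((r + t * ρ)⁻¹ • (w - (y + t • v))) (w - (y + t • v))
  -- The derivative of the `n`-th power contains the truncated exponent `n - 1`, so dimension 0 is
  -- separate.
  rcases n with _ | m
  · simp; field_simp; ring
  · simp only [Nat.add_sub_cancel, Pi.inv_apply, Pi.pow_apply]
    push_cast
    field_simp
    ring

end scaledKernel

/-! ### Smooth averages of Sobolev functions -/

/-- The average of `u` over the ball of center `y` and radius `r` with a smooth weight. -/
noncomputable def smoothAverage {n : ℕ} (u : EuclideanSpace ℝ (Fin n) → ℝ)
    (y : EuclideanSpace ℝ (Fin n)) (r : ℝ) : ℝ :=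
  ∫ w, u w * scaledKernel y r w

section smoothAverage

variable {n : ℕ} {p : ℝ} {Ω S : Set (EuclideanSpace ℝ (Fin n))}
  {u : EuclideanSpace ℝ (Fin n) → ℝ} {g : EuclideanSpace ℝ (Fin n) → EuclideanSpace ℝ (Fin n)}

lemma smoothAverage_eq_setIntegral {y : EuclideanSpace ℝ (Fin n)} {r : ℝ} (hr : 0 < r)
    (hS : Metric.closedBall y r ⊆ S) :
    smoothAverage u y r = ∫ w in S, u w * scaledKernel y r w := by
  refine (setIntegral_eq_integral_of_forall_compl_eq_zero fun w hw => ?_).symm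
  rw [scaledKernel_eq_zero hr (fun h => hw (hS h)), mul_zero]

lemma IsSobolevLocWith.integrableOn_grad (h : IsSobolevLocWith p Ω u g) (hp : 1 ≤ p)
    (hS : IsCompact S) (hSΩ : S ⊆ Ω) : IntegrableOn g S := by
  have : IsFiniteMeasure (volume.restrict S) := ⟨by simpa using hS.measure_lt_top⟩
  exact (h.memLp_grad S hSΩ hS).integrable (by simpa using hp)

/-- The weak gradient integrated against a smooth compactly supported vector field. -/
lemma IsSobolevLocWith.integral_mul_divergence (h : IsSobolevLocWith p Ω u g) (hp : 1 ≤ p)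
    (hΩ : IsOpen Ω) (hu : ContinuousOn u Ω) (hS : IsCompact S) (hSΩ : S ⊆ Ω)
    (Ψ : Fin n → EuclideanSpace ℝ (Fin n) → ℝ) (hΨ : ∀ i, ContDiff ℝ ∞ (Ψ i))
    (hsupp : ∀ i, tsupport (Ψ i) ⊆ S) :
    ∫ w in S, u w * ∑ i, fderiv ℝ (Ψ i) w (EuclideanSpace.single i 1) =
      - ∫ w in S, ∑ i, g w i * Ψ i w := by
  have hg := h.integrableOn_grad hp hS hSΩ
  have hzero : ∀ i, ∀ w ∈ Ω \ S, Ψ i w = 0 := fun i w hw =>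
    image_eq_zero_of_notMem_tsupport fun h => hw.2 (hsupp i h)
  have hzero' : ∀ i, ∀ w ∈ Ω \ S, fderiv ℝ (Ψ i) w = 0 := fun i w hw => by
    by_contra h
    exact hw.2 (hsupp i (support_fderiv_subset ℝ h))
  simp_rw [Finset.mul_sum]
  rw [integral_finsetSum, integral_finsetSum, ← Finset.sum_neg_distrib]
  · refine Finset.sum_congr rfl fun i _ => ?_
    have := h.integral_eq (Ψ i) (hΨ i) (hS.of_isClosed_subset (isClosed_tsupport _) (hsupp i))
      ((hsupp i).trans hSΩ) (EuclideanSpace.single i 1)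
    rw [setIntegral_eq_of_subset_of_forall_sdiff_eq_zero hΩ.measurableSet hSΩ,
      setIntegral_eq_of_subset_of_forall_sdiff_eq_zero hΩ.measurableSet hSΩ] at this
    · simpa [EuclideanSpace.inner_single_right] using this
    · intro w hw; rw [hzero i w hw, mul_zero]
    · intro w hw; simp [hzero' i w hw]
  · intro i _
    have hgi : IntegrableOn (fun w => g w i) S :=
      (EuclideanSpace.proj i : _ →L[ℝ] ℝ).integrable_comp hg
    exact hgi.mul_continuousOn (hΨ i).continuous.continuousOn hS
  · intro i _
    refine ContinuousOn.integrableOn_compact hS ((hu.mono hSΩ).mul ?_)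
    exact (((hΨ i).continuous_fderiv (by simp)).clm_apply continuous_const).continuousOn

/-- The derivative of smooth averages along a segment in the upper half-space. -/
lemma IsSobolevLocWith.hasDerivAt_smoothAverage (h : IsSobolevLocWith p Ω u g) (hp : 1 ≤ p)
    (hΩ : IsOpen Ω) (hu : ContinuousOn u Ω) (hS : IsCompact S) (hSΩ : S ⊆ Ω)
    {y v : EuclideanSpace ℝ (Fin n)} {r ρ a : ℝ} (ha : 0 < a)
    (har : ∀ t ∈ Set.Icc (0 : ℝ) 1, a ≤ r + t * ρ)
    (hball : ∀ t ∈ Set.Icc (0 : ℝ) 1, Metric.closedBall (y + t • v) (r + t * ρ) ⊆ S)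
    {t : ℝ} (ht : t ∈ Set.Ioo (0 : ℝ) 1) :
    HasDerivAt (fun t => smoothAverage u (y + t • v) (r + t * ρ))
      (∫ w in S, inner ℝ (g w) (v + (ρ / (r + t * ρ)) • (w - (y + t • v))) *
        scaledKernel (y + t • v) (r + t * ρ) w) t := by
  obtain ⟨M, hM, hM1, hM2⟩ := exists_bound_unitKernel n
  have hIoo : Set.Ioo (0 : ℝ) 1 ∈ nhds t := Ioo_mem_nhds ht.1 ht.2
  have hpos : ∀ t ∈ Set.Ioo (0 : ℝ) 1, 0 < r + t * ρ := fun t ht =>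
    ha.trans_le (har t (Set.Ioo_subset_Icc_self ht))
  have huS : IntegrableOn u S := (hu.mono hSΩ).integrableOn_compact hS
  set F' : ℝ → EuclideanSpace ℝ (Fin n) → ℝ := fun t w =>
    u w * -(fderiv ℝ (scaledKernel (y + t • v) (r + t * ρ)) w
          (v + (ρ / (r + t * ρ)) • (w - (y + t • v)))
        + n * (ρ / (r + t * ρ)) * scaledKernel (y + t • v) (r + t * ρ) w) with hF'
  have hcont : ∀ t, ContinuousOn (F' t) S := fun t => by
    refine (hu.mono hSΩ).mul (Continuous.continuousOn ?_)
    have h1 : Continuous fun w => fderiv ℝ (scaledKernel (y + t • v) (r + t * ρ)) w :=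
      contDiff_scaledKernel.continuous_fderiv (by simp)
    have h2 : Continuous (scaledKernel (y + t • v) (r + t * ρ)) :=
      contDiff_scaledKernel.continuous
    exact ((h1.clm_apply (by fun_prop)).add (continuous_const.mul h2)).neg
  have key := hasDerivAt_integral_of_dominated_loc_of_deriv_le (μ := volume.restrict S)
    (F := fun t w => u w * scaledKernel (y + t • v) (r + t * ρ) w) (F' := F')
    (bound := fun w => |u w| * ((a ^ n)⁻¹ * a⁻¹ * M * (‖v‖ + |ρ|) +
      n * (|ρ| / a) * ((a ^ n)⁻¹ * M))) hIoo ?_ ?_ ?_ ?_ ?_ ?_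
  · have h2 := key.2
    have h3 : ∫ w in S, F' t w = ∫ w in S,
        inner ℝ (g w) (v + (ρ / (r + t * ρ)) • (w - (y + t • v))) *
        scaledKernel (y + t • v) (r + t * ρ) w := by
      set y' := y + t • v with hy'
      set r' := r + t * ρ with hr'
      have hr'0 : 0 < r' := hpos t ht
      set Ψ : Fin n → EuclideanSpace ℝ (Fin n) → ℝ := fun i w =>
        (v i + (ρ / r') * (w i - y' i)) * scaledKernel y' r' w with hΨ
      have hlin : ∀ i, ContDiff ℝ ∞ fun w : EuclideanSpace ℝ (Fin n) =>
          v i + (ρ / r') * (w i - y' i) := fun i =>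
        contDiff_const.add (contDiff_const.mul
          ((EuclideanSpace.proj i : _ →L[ℝ] ℝ).contDiff.sub contDiff_const))
      have hΨs : ∀ i, ContDiff ℝ ∞ (Ψ i) := fun i => (hlin i).mul contDiff_scaledKernel
      have hdiv := h.integral_mul_divergence hp hΩ hu hS hSΩ Ψ hΨs ?_
      -- Product rule for the divergence: each of the `n` coordinates of the affine field
      -- contributes `ρ / r'`.
      · have e1 : ∀ w, ∑ i, fderiv ℝ (Ψ i) w (EuclideanSpace.single i 1) =
            fderiv ℝ (scaledKernel y' r') w (v + (ρ / r') • (w - y'))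
            + n * (ρ / r') * scaledKernel y' r' w := by
          intro w
          have hk : HasFDerivAt (scaledKernel y' r') (fderiv ℝ (scaledKernel y' r') w) w :=
            ((contDiff_scaledKernel (y := y') (r := r')).differentiable (by simp) w).hasFDerivAt
          have hl : ∀ i, HasFDerivAt (fun w : EuclideanSpace ℝ (Fin n) =>
              v i + (ρ / r') * (w i - y' i)) ((ρ / r') • (EuclideanSpace.proj i : _ →L[ℝ] ℝ)) w :=
            fun i => (((EuclideanSpace.proj i : _ →L[ℝ] ℝ).hasFDerivAt.sub_const
              (y' i)).const_mul (ρ / r')).const_add (v i)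
          have hd : ∀ i, fderiv ℝ (Ψ i) w (EuclideanSpace.single i 1) =
              fderiv ℝ (scaledKernel y' r') w
                ((v + (ρ / r') • (w - y')) i • EuclideanSpace.single i 1) +
              (ρ / r') * scaledKernel y' r' w := by
            intro i
            have := ((hl i).mul hk).fderiv
            have h' : fderiv ℝ (Ψ i) w = _ := this
            rw [h', map_smul]
            simp
            ring
          rw [Finset.sum_congr rfl fun i _ => hd i, Finset.sum_add_distrib, ← map_sum]
          have hb := (EuclideanSpace.basisFun (Fin n) ℝ).sum_repr (v + (ρ / r') • (w - y'))
          simp only [EuclideanSpace.basisFun_apply, EuclideanSpace.basisFun_repr] at hb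
          rw [hb]
          simp [mul_assoc]
        have e2 : ∀ w, ∑ i, g w i * Ψ i w =
            inner ℝ (g w) (v + (ρ / r') • (w - y')) * scaledKernel y' r' w := by
          intro w
          rw [PiLp.inner_apply, Finset.sum_mul]
          refine Finset.sum_congr rfl fun i _ => ?_
          simp [hΨ]
          ring
        simp_rw [e1, e2] at hdiv
        simp only [hF', ← hy', ← hr', mul_neg, integral_neg]
        linarith
      · intro i
        refine (closure_minimal ?_ Metric.isClosed_closedBall).trans
          (hball t (Set.Ioo_subset_Icc_self ht))
        intro w hw
        by_contra hwb
        exact hw (by simp only [hΨ]; rw [scaledKernel_eq_zero hr'0 hwb, mul_zero])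
    rw [h3] at h2
    refine h2.congr_of_eventuallyEq ?_
    filter_upwards [hIoo] with t' ht'
    exact smoothAverage_eq_setIntegral (hpos t' ht') (hball t' (Set.Ioo_subset_Icc_self ht'))
  · filter_upwards with t'
    exact huS.aestronglyMeasurable.mul contDiff_scaledKernel.continuous.aestronglyMeasurable
  · exact huS.mul_continuousOn contDiff_scaledKernel.continuous.continuousOn hS
  · exact (hcont t).aestronglyMeasurable hS.measurableSet
  · refine Filter.Eventually.of_forall fun w t' ht' => ?_
    have hr'0 := hpos t' ht'
    have har' := har t' (Set.Ioo_subset_Icc_self ht')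
    rw [hF', norm_mul, norm_neg, Real.norm_eq_abs]
    refine mul_le_mul_of_nonneg_left ?_ (abs_nonneg _)
    have hrn : ((r + t' * ρ) ^ n)⁻¹ ≤ (a ^ n)⁻¹ := by gcongr
    have hri : (r + t' * ρ)⁻¹ ≤ a⁻¹ := by gcongr
    -- Inside the ball the distance to the center is at most the radius, so the transporting field
    -- has norm at most `‖v‖ + |ρ|`; outside, the kernel and its derivative vanish.
    by_cases hw : w ∈ Metric.closedBall (y + t' • v) (r + t' * ρ)
    · refine (norm_add_le _ _).trans (add_le_add ?_ ?_)
      · refine (ContinuousLinearMap.le_opNorm _ _).trans ?_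
        rw [hasFDerivAt_scaledKernel.fderiv, norm_smul, Real.norm_of_nonneg (by positivity)]
        gcongr
        · exact hM2 _
        · refine (norm_add_le _ _).trans (add_le_add le_rfl ?_)
          rw [Metric.mem_closedBall, dist_eq_norm] at hw
          rw [norm_smul, norm_div, Real.norm_of_nonneg hr'0.le, Real.norm_eq_abs, div_mul_eq_mul_div,
            div_le_iff₀ hr'0]
          gcongr
      · rw [norm_mul, norm_mul, norm_div, Real.norm_of_nonneg hr'0.le, Real.norm_eq_abs,
          Real.norm_eq_abs, Real.norm_eq_abs, abs_of_nonneg (scaledKernel_nonneg hr'0), Nat.abs_cast]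
        gcongr
        · exact scaledKernel_nonneg hr'0
        · exact scaledKernel_le ha har' hM1
    · rw [scaledKernel_eq_zero hr'0 hw, hasFDerivAt_scaledKernel.fderiv,
        fderiv_unitKernel_eq_zero (one_lt_norm_inv_smul_sub hr'0 hw)]
      simp
      positivity
  · exact huS.abs.mul_const _
  · refine Filter.Eventually.of_forall fun w t' ht' => ?_
    exact (hasDerivAt_scaledKernel y v w r ρ t' (hpos t' ht')).const_mul (u w)

/-- This plays the role of the Poincaré inequality. By the mean value theorem the difference is one
value of the derivative, in which the field is at most `‖v‖ + |ρ|` and the kernel at most `M / a ^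
n`. -/
lemma exists_abs_smoothAverage_sub_le (n : ℕ) :
    ∃ M : ℝ, 0 < M ∧ ∀ (p : ℝ) (Ω S : Set (EuclideanSpace ℝ (Fin n)))
      (u : EuclideanSpace ℝ (Fin n) → ℝ) (g : EuclideanSpace ℝ (Fin n) → EuclideanSpace ℝ (Fin n)),
      IsSobolevLocWith p Ω u g → 1 ≤ p → IsOpen Ω → ContinuousOn u Ω → IsCompact S → S ⊆ Ω →
      ∀ (y v : EuclideanSpace ℝ (Fin n)) (r ρ a : ℝ), 0 < a →
      (∀ t ∈ Set.Icc (0 : ℝ) 1, a ≤ r + t * ρ) →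
      (∀ t ∈ Set.Icc (0 : ℝ) 1, Metric.closedBall (y + t • v) (r + t * ρ) ⊆ S) →
      |smoothAverage u (y + v) (r + ρ) - smoothAverage u y r| ≤
        M * (‖v‖ + |ρ|) * (a ^ n)⁻¹ * ∫ w in S, ‖g w‖ := by
  obtain ⟨M, hM, hM1, -⟩ := exists_bound_unitKernel n
  refine ⟨M, hM, fun p Ω S u g h hp hΩ hu hS hSΩ y v r ρ a ha har hball => ?_⟩
  have hpos : ∀ t ∈ Set.Icc (0 : ℝ) 1, 0 < r + t * ρ := fun t ht => ha.trans_le (har t ht)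
  have huS : IntegrableOn u S := (hu.mono hSΩ).integrableOn_compact hS
  have hcont : ContinuousOn (fun t => smoothAverage u (y + t • v) (r + t * ρ))
      (Set.Icc (0 : ℝ) 1) := by
    have : ContinuousOn (fun t => ∫ w in S, u w * scaledKernel (y + t • v) (r + t * ρ) w)
        (Set.Icc (0 : ℝ) 1) := by
      refine continuousOn_of_dominated (bound := fun w => |u w| * ((a ^ n)⁻¹ * M)) ?_ ?_
        (huS.abs.mul_const _) ?_
      · intro t _
        exact huS.aestronglyMeasurable.mul contDiff_scaledKernel.continuous.aestronglyMeasurable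
      · refine fun t ht => Filter.Eventually.of_forall fun w => ?_
        rw [norm_mul, Real.norm_eq_abs, Real.norm_of_nonneg (scaledKernel_nonneg (hpos t ht))]
        gcongr
        exact scaledKernel_le ha (har t ht) hM1
      · refine Filter.Eventually.of_forall fun w t ht => ?_
        exact ((hasDerivAt_scaledKernel y v w r ρ t
          (hpos t ht)).const_mul (u w)).continuousAt.continuousWithinAt
    exact this.congr fun t ht => smoothAverage_eq_setIntegral (hpos t ht) (hball t ht)
  obtain ⟨t, ht, hslope⟩ := exists_hasDerivAt_eq_slope _ _ one_pos hcont
    fun t ht => h.hasDerivAt_smoothAverage hp hΩ hu hS hSΩ ha har hball ht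
  simp only [one_smul, one_mul, zero_smul, zero_mul, add_zero, sub_zero, div_one] at hslope
  rw [← hslope, ← integral_const_mul, ← Real.norm_eq_abs]
  refine norm_integral_le_of_norm_le ((h.integrableOn_grad hp hS hSΩ).norm.const_mul _)
    (Filter.Eventually.of_forall fun w => ?_)
  have ht' := Set.Ioo_subset_Icc_self ht
  have hr'0 := hpos t ht'
  by_cases hw : w ∈ Metric.closedBall (y + t • v) (r + t * ρ)
  · have h1 : ‖v + (ρ / (r + t * ρ)) • (w - (y + t • v))‖ ≤ ‖v‖ + |ρ| := by
      refine (norm_add_le _ _).trans (add_le_add le_rfl ?_)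
      rw [Metric.mem_closedBall, dist_eq_norm] at hw
      rw [norm_smul, norm_div, Real.norm_of_nonneg hr'0.le, Real.norm_eq_abs, div_mul_eq_mul_div,
        div_le_iff₀ hr'0]
      gcongr
    rw [norm_mul, Real.norm_of_nonneg (scaledKernel_nonneg hr'0)]
    calc _ ≤ (‖g w‖ * (‖v‖ + |ρ|)) * ((a ^ n)⁻¹ * M) := by
          refine mul_le_mul ?_ (scaledKernel_le ha (har t ht') hM1) (scaledKernel_nonneg hr'0)
            (by positivity)
          exact (norm_inner_le_norm _ _).trans (by gcongr)
      _ = _ := by ring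
  · rw [scaledKernel_eq_zero hr'0 hw]
    simp
    positivity

/-- Hölder's inequality on a set of finite measure. -/
lemma setIntegral_norm_le_rpow_mul {α F : Type*} [MeasurableSpace α] {μ : Measure α}
    [NormedAddCommGroup F] {f : α → F} {p : ℝ} (hp : 1 ≤ p) {S : Set α} (hS : μ S ≠ ⊤)
    (hf : MemLp f (ENNReal.ofReal p) (μ.restrict S)) :
    ∫ w in S, ‖f w‖ ∂μ ≤
      (μ S).toReal ^ (1 - 1 / p) * (∫⁻ w in S, ‖f w‖ₑ ^ p ∂μ).toReal ^ (1 / p) := by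
  have hp0 : 0 < p := by linarith
  have hle := eLpNorm_le_eLpNorm_mul_rpow_measure_univ (p := 1) (q := ENNReal.ofReal p)
    (by simpa using hp) hf.aestronglyMeasurable
  have hfin := hf.eLpNorm_ne_top
  rw [integral_norm_eq_lintegral_enorm hf.aestronglyMeasurable]
  rw [eLpNorm_eq_lintegral_rpow_enorm_toReal (p := ENNReal.ofReal p) (by simpa using hp0) (by simp),
    ENNReal.toReal_ofReal hp0.le] at hle hfin
  rw [eLpNorm_one_eq_lintegral_enorm, Measure.restrict_apply_univ, ENNReal.toReal_one,
    div_one] at hle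
  have hexp : 0 ≤ 1 - 1 / p := by
    rw [sub_nonneg, div_le_one hp0]; exact hp
  have := ENNReal.toReal_mono (ENNReal.mul_ne_top hfin
    (ENNReal.rpow_ne_top_of_nonneg hexp hS)) hle
  rwa [ENNReal.toReal_mul, ← ENNReal.toReal_rpow, ← ENNReal.toReal_rpow, mul_comm] at this

lemma IsSobolevLocWith.lintegral_rpow_ne_top (h : IsSobolevLocWith p Ω u g) (hp : 1 ≤ p)
    (hS : IsCompact S) (hSΩ : S ⊆ Ω) : ∫⁻ w in S, ‖g w‖ₑ ^ p ≠ ⊤ := by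
  have hp0 : 0 < p := by linarith
  have := lintegral_rpow_enorm_lt_top_of_eLpNorm_lt_top (by simpa using hp0) (by simp)
    (h.memLp_grad S hSΩ hS).eLpNorm_lt_top
  rw [ENNReal.toReal_ofReal hp0.le] at this
  exact this.ne

/-- Comparison of smooth averages along a segment in the upper half-space. -/
lemma exists_abs_smoothAverage_sub_le_rpow (n : ℕ) {p : ℝ} (hp : 1 ≤ p) {K : ℝ} (hK : 0 < K) :
    ∃ M : ℝ, 0 < M ∧ ∀ (Ω S : Set (EuclideanSpace ℝ (Fin n)))
      (u : EuclideanSpace ℝ (Fin n) → ℝ) (g : EuclideanSpace ℝ (Fin n) → EuclideanSpace ℝ (Fin n)),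
      IsSobolevLocWith p Ω u g → IsOpen Ω → ContinuousOn u Ω → IsCompact S → S ⊆ Ω →
      ∀ (y y' z : EuclideanSpace ℝ (Fin n)) (r r' a : ℝ), 0 < a → S ⊆ Metric.closedBall z (K * a) →
      a ≤ r → a ≤ r' →
      (∀ t ∈ Set.Icc (0 : ℝ) 1,
        Metric.closedBall (y + t • (y' - y)) (r + t * (r' - r)) ⊆ S) →
      |smoothAverage u y' r' - smoothAverage u y r| ≤
        M * (dist y y' + |r' - r|) * a ^ (-(n / p : ℝ)) *
          (∫⁻ w in S, ‖g w‖ₑ ^ p).toReal ^ (1 / p) := by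
  obtain ⟨M, hM, key⟩ := exists_abs_smoothAverage_sub_le n
  have hp0 : 0 < p := by linarith
  have hexp : 0 ≤ 1 - 1 / p := by
    rw [sub_nonneg, div_le_one hp0]; exact hp
  set m := (volume (Metric.ball (0 : EuclideanSpace ℝ (Fin n)) 1)).toReal with hm
  have hm0 : 0 < m := ENNReal.toReal_pos (Metric.measure_ball_pos _ _ one_pos).ne'
    measure_ball_lt_top.ne
  refine ⟨M * (K ^ n * m) ^ (1 - 1 / p), by positivity,
    fun Ω S u g h hΩ hu hS hSΩ y y' z r r' a ha hSz har har' hball => ?_⟩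
  have h1 := key p Ω S u g h hp hΩ hu hS hSΩ y (y' - y) r (r' - r) a ha ?_ hball
  · rw [add_sub_cancel, add_sub_cancel] at h1
    refine h1.trans ?_
    rw [← dist_eq_norm, dist_comm y' y]
    have h2 := setIntegral_norm_le_rpow_mul hp hS.measure_lt_top.ne (h.memLp_grad S hSΩ hS)
    have h3 : (volume S).toReal ≤ (K ^ n * m) * a ^ n := by
      refine (ENNReal.toReal_mono measure_closedBall_lt_top.ne (measure_mono hSz)).trans ?_
      rw [Measure.addHaar_closedBall _ _ (by positivity), ENNReal.toReal_mul,
        ENNReal.toReal_ofReal (by positivity), finrank_euclideanSpace_fin, ← hm, mul_pow]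
      exact le_of_eq (by ring)
    -- The kernel contributes `a^(-n)` and the volume factor in Hölder's inequality contributes
    -- `a^(n(1-1/p))`.
    have h4 : (a ^ n)⁻¹ * (a ^ n) ^ (1 - 1 / p) = a ^ (-(n / p : ℝ)) := by
      rw [← Real.rpow_natCast a n, ← Real.rpow_neg ha.le, ← Real.rpow_mul ha.le,
        ← Real.rpow_add ha]
      congr 1; ring
    calc _ ≤ M * (dist y y' + |r' - r|) * (a ^ n)⁻¹ * (((K ^ n * m) * a ^ n) ^ (1 - 1 / p) *
          (∫⁻ w in S, ‖g w‖ₑ ^ p).toReal ^ (1 / p)) := by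
          gcongr
          exact h2.trans (by gcongr)
      _ = M * (K ^ n * m) ^ (1 - 1 / p) * (dist y y' + |r' - r|) *
          ((a ^ n)⁻¹ * (a ^ n) ^ (1 - 1 / p)) * (∫⁻ w in S, ‖g w‖ₑ ^ p).toReal ^ (1 / p) := by
          rw [Real.mul_rpow (by positivity) (by positivity)]; ring
      _ = _ := by rw [h4]
  · intro t ht
    nlinarith [ht.1, ht.2, mul_nonneg (sub_nonneg.2 ht.2) (sub_nonneg.2 har),
      mul_nonneg ht.1 (sub_nonneg.2 har')]

lemma one_le_smoothAverage {y : EuclideanSpace ℝ (Fin n)} {r : ℝ} (hr : 0 < r)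
    (hu : ContinuousOn u (Metric.closedBall y r)) (h1 : ∀ w ∈ Metric.closedBall y r, 1 ≤ u w) :
    1 ≤ smoothAverage u y r := by
  rw [← integral_scaledKernel (y := y) hr, smoothAverage_eq_setIntegral hr le_rfl,
    ← setIntegral_eq_integral_of_forall_compl_eq_zero (s := Metric.closedBall y r)
      fun w hw => scaledKernel_eq_zero hr hw]
  have hc : ContinuousOn (scaledKernel y r) (Metric.closedBall y r) :=
    contDiff_scaledKernel.continuous.continuousOn
  refine setIntegral_mono_on (hc.integrableOn_compact (isCompact_closedBall _ _))
    ((hu.mul hc).integrableOn_compact (isCompact_closedBall _ _)) measurableSet_closedBall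
    fun w hw => ?_
  exact le_mul_of_one_le_left (scaledKernel_nonneg hr) (h1 w hw)

lemma smoothAverage_le {y : EuclideanSpace ℝ (Fin n)} {r b : ℝ} (hr : 0 < r)
    (hu : ContinuousOn u (Metric.closedBall y r)) (h1 : ∀ w ∈ Metric.closedBall y r, u w ≤ b) :
    smoothAverage u y r ≤ b := by
  rw [← mul_one b, ← integral_scaledKernel (y := y) hr, smoothAverage_eq_setIntegral hr le_rfl,
    ← setIntegral_eq_integral_of_forall_compl_eq_zero (s := Metric.closedBall y r)
      fun w hw => scaledKernel_eq_zero hr hw, ← integral_const_mul]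
  have hc : ContinuousOn (scaledKernel y r) (Metric.closedBall y r) :=
    contDiff_scaledKernel.continuous.continuousOn
  refine setIntegral_mono_on ((hu.mul hc).integrableOn_compact (isCompact_closedBall _ _))
    ((continuousOn_const.mul hc).integrableOn_compact (isCompact_closedBall _ _))
    measurableSet_closedBall fun w hw => ?_
  exact mul_le_mul_of_nonneg_right (h1 w hw) (scaledKernel_nonneg hr)

end smoothAverage

/-! ### Chains of balls along a curve -/

/-- The last time at which a curve is within distance `r` of its position at time `t`. -/
lemma exists_last_exit {X : Type*} [PseudoMetricSpace X] {γ : ℝ → X}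
    (hγ : ContinuousOn γ (Set.Icc 0 1)) {t r : ℝ} (ht : t ∈ Set.Icc (0 : ℝ) 1) (hr : 0 ≤ r) :
    ∃ t' ∈ Set.Icc t 1, dist (γ t) (γ t') ≤ r ∧
      (t' ≠ 1 → r ≤ dist (γ t) (γ t') ∧ ∀ τ ∈ Set.Ioc t' 1, r < dist (γ t) (γ τ)) := by
  have hγt : ContinuousOn (fun τ => dist (γ t) (γ τ)) (Set.Icc t 1) :=
    (continuous_const.dist continuous_id).comp_continuousOn
      (hγ.mono (Set.Icc_subset_Icc_left ht.1))
  have hcomp : IsCompact (Set.Icc t 1 ∩ (fun τ => dist (γ t) (γ τ)) ⁻¹' Set.Iic r) :=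
    isCompact_Icc.of_isClosed_subset (hγt.preimage_isClosed_of_isClosed isClosed_Icc isClosed_Iic)
      Set.inter_subset_left
  obtain ⟨t', ⟨ht', hdist⟩, hmax⟩ := hcomp.exists_isGreatest
    ⟨t, ⟨le_rfl, ht.2⟩, by simpa using hr⟩
  have hlast : ∀ τ ∈ Set.Ioc t' 1, r < dist (γ t) (γ τ) := fun τ hτ => by
    by_contra hle
    exact (hτ.1.trans_le (hmax ⟨⟨ht'.1.trans hτ.1.le, hτ.2⟩, not_lt.1 hle⟩)).false
  refine ⟨t', ht', hdist, fun hne => ⟨?_, hlast⟩⟩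
  have hlt : t' < 1 := lt_of_le_of_ne ht'.2 hne
  -- All later points are farther than `r`; continuity from the right carries the weak inequality to
  -- `t'`.
  have hlim : Filter.Tendsto (fun τ => dist (γ t) (γ τ)) (nhdsWithin t' (Set.Ioc t' 1))
      (nhds (dist (γ t) (γ t'))) :=
    (hγt t' ht').mono_left (nhdsWithin_mono _ fun τ hτ => ⟨ht'.1.trans hτ.1.le, hτ.2⟩)
  have : (nhdsWithin t' (Set.Ioc t' 1)).NeBot := by
    rw [nhdsWithin_Ioc_eq_nhdsGT hlt]; infer_instance
  refine ge_of_tendsto hlim ?_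
  filter_upwards [self_mem_nhdsWithin] with τ hτ using (hlast τ hτ).le

/-- Points along a curve, each at a prescribed distance from the preceding ones. -/
lemma exists_separated_times {X : Type*} [PseudoMetricSpace X] {γ : ℝ → X}
    (hγ : ContinuousOn γ (Set.Icc 0 1)) {ρ : X → ℝ} {b : ℝ} (hb : 0 < b)
    (hρ : ∀ t ∈ Set.Icc (0 : ℝ) 1, b ≤ ρ (γ t)) :
    ∃ (N : ℕ) (T : ℕ → ℝ), 0 < N ∧ T 0 = 0 ∧ T N = 1 ∧ Monotone T ∧
      (∀ k, T k ∈ Set.Icc (0 : ℝ) 1) ∧ (∀ k, dist (γ (T k)) (γ (T (k + 1))) ≤ ρ (γ (T k))) ∧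
      ∀ i j, i < j → j < N → ρ (γ (T i)) ≤ dist (γ (T i)) (γ (T j)) := by
  have hex : ∀ t : ℝ, ∃ t' : ℝ, t ∈ Set.Icc (0 : ℝ) 1 → t' ∈ Set.Icc t 1 ∧
      dist (γ t) (γ t') ≤ ρ (γ t) ∧ (t' ≠ 1 → ρ (γ t) ≤ dist (γ t) (γ t') ∧
        ∀ τ ∈ Set.Ioc t' 1, ρ (γ t) < dist (γ t) (γ τ)) := by
    intro t
    by_cases ht : t ∈ Set.Icc (0 : ℝ) 1
    · obtain ⟨t', h1, h2⟩ := exists_last_exit hγ ht (hb.le.trans (hρ t ht))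
      exact ⟨t', fun _ => ⟨h1, h2⟩⟩
    · exact ⟨0, fun h => absurd h ht⟩
  choose next hnext using hex
  set T : ℕ → ℝ := fun k => next^[k] 0 with hT
  have hsucc : ∀ k, T (k + 1) = next (T k) := fun k => Function.iterate_succ_apply' _ _ _
  have hmem : ∀ k, T k ∈ Set.Icc (0 : ℝ) 1 := by
    intro k
    induction k with
    | zero => simp [hT]
    | succ k ih =>
      rw [hsucc]
      exact ⟨ih.1.trans (hnext _ ih).1.1, (hnext _ ih).1.2⟩
  have hmono : Monotone T := monotone_nat_of_le_succ fun k => by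
    rw [hsucc]; exact (hnext _ (hmem k)).1.1
  -- Otherwise the increasing times converge, while consecutive points of the curve stay at distance
  -- at least `b`, against continuity at the limit.
  have hend : ∃ N, T N = 1 := by
    by_contra! hne
    have hlim := tendsto_atTop_ciSup hmono ⟨1, by rintro _ ⟨k, rfl⟩; exact (hmem k).2⟩
    set t := ⨆ k, T k
    have ht : t ∈ Set.Icc (0 : ℝ) 1 := isClosed_Icc.mem_of_tendsto hlim
      (Filter.Eventually.of_forall hmem)
    have hγlim : Filter.Tendsto (fun k => γ (T k)) Filter.atTop (nhds (γ t)) :=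
      (hγ t ht).tendsto.comp (tendsto_nhdsWithin_iff.2 ⟨hlim, Filter.Eventually.of_forall hmem⟩)
    have h0 := hγlim.dist (hγlim.comp (Filter.tendsto_add_atTop_nat 1))
    rw [dist_self] at h0
    refine hb.not_ge (ge_of_tendsto h0 (Filter.Eventually.of_forall fun k => ?_))
    have := ((hnext _ (hmem k)).2.2 (by rw [← hsucc]; exact hne _)).1
    rw [← hsucc] at this
    exact (hρ _ (hmem k)).trans this
  classical
  -- With the least such index, `T (i + 1) ≠ 1` whenever `i < j < N`, so it is a genuine exit time,
  -- which separation requires.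
  refine ⟨Nat.find hend, T, ?_, rfl, Nat.find_spec hend, hmono, hmem, fun k => ?_,
    fun i j hij hj => ?_⟩
  · rw [Nat.find_pos]; simp [hT]
  · rw [hsucc]; exact (hnext _ (hmem k)).2.1
  · have hne : T (i + 1) ≠ 1 := Nat.find_min hend (lt_of_le_of_lt hij hj)
    obtain ⟨h1, h2⟩ := (hnext _ (hmem i)).2.2 (by rw [← hsucc]; exact hne)
    rw [← hsucc] at h1 h2
    rcases (hmono (Nat.succ_le_of_lt hij)).eq_or_lt with h | h
    · rw [← h]; exact h1
    · exact (h2 _ ⟨h, (hmem j).2⟩).le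

/-- The chain of balls along an `s`-John curve; `ℓ i` is the length of the curve up to the `i`-th
center. -/
lemma IsSJohnCurve.exists_chain {X : Type*} [PseudoMetricSpace X] {s C : ℝ} {Ω : Set X} {x x₀ : X}
    {γ : ℝ → X} (h : IsSJohnCurve s C Ω x x₀ γ) (hs : 1 ≤ s) (hC : 0 ≤ C)
    (hpos : ∀ y ∈ Ω, 0 < Metric.infDist y (frontier Ω)) :
    ∃ (N : ℕ) (c : ℕ → X) (ℓ : ℕ → ℝ), 0 < N ∧ c 0 = x ∧ c N = x₀ ∧ (∀ k, c k ∈ Ω) ∧ ℓ 0 = 0 ∧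
      (∀ k, dist (c k) (c (k + 1)) ≤ ℓ (k + 1) - ℓ k) ∧
      (∀ k, ℓ k ^ s ≤ C * Metric.infDist (c k) (frontier Ω)) ∧
      (∀ k, dist (c k) (c (k + 1)) ≤ Metric.infDist (c k) (frontier Ω) / 8) ∧
      ∀ i j, i < j → j < N → Metric.infDist (c i) (frontier Ω) / 8 ≤ dist (c i) (c j) := by
  have hcont : ContinuousOn (fun t => Metric.infDist (γ t) (frontier Ω) / 8) (Set.Icc 0 1) :=
    ((Metric.continuous_infDist_pt _).comp_continuousOn h.continuousOn).div_const 8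
  obtain ⟨t₀, ht₀, hmin⟩ := isCompact_Icc.exists_isMinOn
    (Set.nonempty_Icc.2 (zero_le_one' ℝ)) hcont
  obtain ⟨N, T, hN, h0, h1, hmono, hmem, hstep, hsep⟩ := exists_separated_times h.continuousOn
    (ρ := fun y => Metric.infDist y (frontier Ω) / 8)
    (b := Metric.infDist (γ t₀) (frontier Ω) / 8) (by linarith [hpos _ (h.mapsTo ht₀)])
    fun t ht => hmin ht
  have hfin : ∀ k, eVariationOn γ (Set.Icc 0 (T k)) ≠ ⊤ := fun k =>
    ne_top_of_le_ne_top h.rectifiable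
      (eVariationOn.mono _ (Set.Icc_subset_Icc_right (hmem k).2))
  refine ⟨N, fun k => γ (T k), fun k => (eVariationOn γ (Set.Icc 0 (T k))).toReal, hN,
    by simp [h0, h.source], by simp [h1, h.target], fun k => h.mapsTo (hmem k),
    by simp [h0, eVariationOn.subsingleton], fun k => ?_, fun k => ?_, hstep, hsep⟩
  · have hadd := eVariationOn.Icc_add_Icc γ (s := Set.Icc 0 (T (k + 1))) (hmem k).1
      (hmono (Nat.le_succ k)) ⟨(hmem k).1, hmono (Nat.le_succ k)⟩
    have hsub1 : Set.Icc 0 (T (k + 1)) ∩ Set.Icc 0 (T k) = Set.Icc 0 (T k) :=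
      Set.inter_eq_right.2 (Set.Icc_subset_Icc_right (hmono (Nat.le_succ k)))
    rw [hsub1, Set.inter_self] at hadd
    have hed : edist (γ (T k)) (γ (T (k + 1))) ≤
        eVariationOn γ (Set.Icc 0 (T (k + 1)) ∩ Set.Icc (T k) (T (k + 1))) :=
      eVariationOn.edist_le _ ⟨⟨(hmem k).1, hmono (Nat.le_succ k)⟩, le_rfl, hmono (Nat.le_succ k)⟩
        ⟨⟨(hmem _).1, le_rfl⟩, hmono (Nat.le_succ k), le_rfl⟩
    have hfin2 : eVariationOn γ (Set.Icc 0 (T (k + 1)) ∩ Set.Icc (T k) (T (k + 1))) ≠ ⊤ :=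
      ne_top_of_le_ne_top (hfin (k + 1)) (eVariationOn.mono _ Set.inter_subset_left)
    beta_reduce
    rw [← hadd, ENNReal.toReal_add (hfin k) hfin2, add_sub_cancel_left, dist_edist]
    exact ENNReal.toReal_mono hfin2 hed
  · beta_reduce
    -- The John condition says nothing at `t = 0`, but there the length is 0 and `0 ^ s = 0`.
    rcases (hmem k).1.eq_or_lt with h' | h'
    · rw [← h']
      simp only [Set.Icc_self]
      rw [eVariationOn.subsingleton _ Set.subsingleton_singleton, ENNReal.toReal_zero,
        Real.zero_rpow (by linarith)]
      exact mul_nonneg hC Metric.infDist_nonneg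
    · exact h.twisted _ ⟨h', (hmem k).2⟩

/-! ### Overlap and sums along chains -/

/-- Bounded overlap of the enlarged balls of a chain. -/
lemma card_le_of_separated {n : ℕ} {F : Set (EuclideanSpace ℝ (Fin n))}
    {c : ℕ → EuclideanSpace ℝ (Fin n)} {J : Finset ℕ}
    (hpos : ∀ i ∈ J, 0 < Metric.infDist (c i) F)
    (hsep : ∀ i ∈ J, ∀ j ∈ J, i < j → Metric.infDist (c i) F / 8 ≤ dist (c i) (c j))
    {z : EuclideanSpace ℝ (Fin n)} (hz : ∀ i ∈ J, dist z (c i) ≤ 3 * (Metric.infDist (c i) F / 8)) :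
    J.card ≤ 22 ^ n := by
  rcases J.eq_empty_or_nonempty with rfl | ⟨i₀, hi₀⟩
  · simp
  set d := Metric.infDist z F with hd
  -- With `r` the radius at `c i`, the distance to `F` is `8r` at `c i` and changes by at most `3r`
  -- up to `z`, so `5r ≤ d ≤ 11r`. The radii are thus comparable, and balls of radius `d / 33`
  -- around the centers are disjoint; volume comparison counts them.
  have hle1 : ∀ i ∈ J, 5 * (Metric.infDist (c i) F / 8) ≤ d := fun i hi => by
    have := Metric.infDist_le_infDist_add_dist (x := c i) (y := z) (s := F)
    rw [dist_comm] at this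
    linarith [hz i hi]
  have hle2 : ∀ i ∈ J, d ≤ 11 * (Metric.infDist (c i) F / 8) := fun i hi => by
    have := Metric.infDist_le_infDist_add_dist (x := z) (y := c i) (s := F)
    linarith [hz i hi]
  have hd0 : 0 < d := by linarith [hle1 i₀ hi₀, hpos i₀ hi₀]
  have hdist : ∀ i ∈ J, ∀ j ∈ J, i < j → d / 33 + d / 33 ≤ dist (c i) (c j) :=
    fun i hi j hj hij => by linarith [hsep i hi j hj hij, hle2 i hi]
  have hdisj : (J : Set ℕ).PairwiseDisjoint fun i => Metric.ball (c i) (d / 33) := by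
    intro i hi j hj hij
    rcases lt_or_gt_of_ne hij with h | h
    · exact Metric.ball_disjoint_ball (hdist i hi j hj h)
    · exact (Metric.ball_disjoint_ball (hdist j hj i hi h)).symm
  have hsub : (⋃ i ∈ J, Metric.ball (c i) (d / 33)) ⊆ Metric.ball z (22 * (d / 33)) := by
    refine Set.iUnion₂_subset fun i hi => Metric.ball_subset_ball' ?_
    rw [dist_comm]
    linarith [hz i hi, hle1 i hi]
  have hvol := measure_mono (μ := volume) hsub
  rw [measure_biUnion_finset hdisj fun i _ => measurableSet_ball] at hvol
  simp_rw [Measure.addHaar_ball_of_pos volume (_ : EuclideanSpace ℝ (Fin n))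
    (show 0 < d / 33 by positivity)] at hvol
  rw [Measure.addHaar_ball_of_pos volume z (show 0 < 22 * (d / 33) by positivity),
    Finset.sum_const, nsmul_eq_mul, ← mul_assoc,
    ENNReal.mul_le_mul_iff_left (Metric.measure_ball_pos _ _ one_pos).ne' measure_ball_lt_top.ne,
    finrank_euclideanSpace_fin, mul_pow, ENNReal.ofReal_mul (by positivity),
    ENNReal.mul_le_mul_iff_left (ENNReal.ofReal_pos.2 (by positivity)).ne' (by simp),
    ← ENNReal.ofReal_natCast, ENNReal.ofReal_le_ofReal_iff (by positivity)] at hvol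
  exact_mod_cast hvol

/-- By bounded overlap the indicators of the balls add up to at most `22 ^ n` times that of `A`;
integrate against `ν`. -/
lemma sum_measure_closedBall_le {n : ℕ} {F : Set (EuclideanSpace ℝ (Fin n))}
    {c : ℕ → EuclideanSpace ℝ (Fin n)} {J : Finset ℕ}
    (hpos : ∀ i ∈ J, 0 < Metric.infDist (c i) F)
    (hsep : ∀ i ∈ J, ∀ j ∈ J, i < j → Metric.infDist (c i) F / 8 ≤ dist (c i) (c j))
    (ν : Measure (EuclideanSpace ℝ (Fin n))) {A : Set (EuclideanSpace ℝ (Fin n))}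
    (hA : MeasurableSet A)
    (hsub : ∀ i ∈ J, Metric.closedBall (c i) (3 * (Metric.infDist (c i) F / 8)) ⊆ A) :
    ∑ i ∈ J, ν (Metric.closedBall (c i) (3 * (Metric.infDist (c i) F / 8))) ≤ 22 ^ n * ν A := by
  classical
  calc _ = ∑ i ∈ J, ∫⁻ z, (Metric.closedBall (c i)
        (3 * (Metric.infDist (c i) F / 8))).indicator 1 z ∂ν :=
        Finset.sum_congr rfl fun i _ => (lintegral_indicator_one measurableSet_closedBall).symm
    _ = ∫⁻ z, ∑ i ∈ J, (Metric.closedBall (c i)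
        (3 * (Metric.infDist (c i) F / 8))).indicator 1 z ∂ν :=
        (lintegral_finsetSum _ fun i _ =>
          measurable_one.indicator measurableSet_closedBall).symm
    _ ≤ ∫⁻ z, A.indicator (fun _ => 22 ^ n) z ∂ν := by
        refine lintegral_mono fun z => ?_
        by_cases hz : z ∈ A
        · simp only [Set.indicator_apply, Pi.one_apply, Finset.sum_boole, if_pos hz]
          have := card_le_of_separated (F := F) (c := c) (z := z)
            (J := J.filter fun i => z ∈ Metric.closedBall (c i) (3 * (Metric.infDist (c i) F / 8)))
            (fun i hi => hpos i (Finset.mem_filter.1 hi).1)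
            (fun i hi j hj => hsep i (Finset.mem_filter.1 hi).1 j (Finset.mem_filter.1 hj).1)
            (fun i hi => (Finset.mem_filter.1 hi).2)
          exact_mod_cast this
        · rw [Set.indicator_of_notMem hz, Finset.sum_eq_zero]
          exact fun i hi => Set.indicator_of_notMem (fun h => hz (hsub i hi h)) _
    _ = _ := lintegral_indicator_const hA _

/-- Increments of a nonnegative sequence that end below `m` add up to at most `m`. -/
lemma sum_increments_le {ℓ : ℕ → ℝ} (h0 : ℓ 0 = 0) (hmono : Monotone ℓ) {m : ℝ} (hm : 0 ≤ m)
    (N : ℕ) : ∑ i ∈ Finset.range N with ℓ (i + 1) ≤ m, (ℓ (i + 1) - ℓ i) ≤ m := by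
  have : ∑ i ∈ Finset.range N with ℓ (i + 1) ≤ m, (ℓ (i + 1) - ℓ i) ≤ min (ℓ N) m := by
    induction N with
    | zero => simp [h0, hm]
    | succ N ih =>
      rw [Finset.range_add_one, Finset.filter_insert]
      have := hmono (Nat.le_succ N)
      split_ifs with h
      · rw [Finset.sum_insert (by simp)]
        refine le_min ?_ ?_ <;> linarith [ih.trans (min_le_left _ _), h]
      · exact ih.trans (min_le_min_right _ this)
  exact this.trans (min_le_right _ _)

/-! ### Distance to the boundary -/

section frontier

variable {n : ℕ} {Ω : Set (EuclideanSpace ℝ (Fin n))}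

lemma frontier_nonempty_of_isBounded (hn : n ≠ 0) (hne : Ω.Nonempty) (hΩ : Bornology.IsBounded Ω) :
    (frontier Ω).Nonempty := by
  have : Nontrivial (EuclideanSpace ℝ (Fin n)) := by
    have : Nonempty (Fin n) := ⟨⟨0, Nat.pos_of_ne_zero hn⟩⟩
    infer_instance
  rw [nonempty_frontier_iff]
  refine ⟨hne, fun h => ?_⟩
  rw [h] at hΩ
  exact NormedSpace.unbounded_univ ℝ (EuclideanSpace ℝ (Fin n)) hΩ

lemma infDist_frontier_pos (hΩ : IsOpen Ω) (hF : (frontier Ω).Nonempty)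
    {y : EuclideanSpace ℝ (Fin n)} (hy : y ∈ Ω) : 0 < Metric.infDist y (frontier Ω) := by
  rw [← isClosed_frontier.notMem_iff_infDist_pos hF]
  intro h
  exact (hΩ.inter_frontier_eq.subset ⟨hy, h⟩)

/-- A nearest point of the complement lies on the boundary, so the complement is no closer than the
boundary. -/
lemma closedBall_subset_of_lt_infDist_frontier (hF : (frontier Ω).Nonempty)
    {y : EuclideanSpace ℝ (Fin n)} (hy : y ∈ Ω) {r : ℝ}
    (hr : r < Metric.infDist y (frontier Ω)) : Metric.closedBall y r ⊆ Ω := by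
  have hne : Ω ≠ Set.univ := by rintro rfl; simp at hF
  obtain ⟨z, hz, hyz⟩ := exists_mem_frontier_infDist_compl_eq_dist hy hne
  exact (Metric.closedBall_subset_ball (hr.trans_le ((Metric.infDist_le_dist_of_mem hz).trans
    hyz.ge))).trans Metric.ball_infDist_compl_subset

lemma infDist_frontier_le_diam (hΩ : Bornology.IsBounded Ω) (hF : (frontier Ω).Nonempty)
    {y : EuclideanSpace ℝ (Fin n)} (hy : y ∈ Ω) :
    Metric.infDist y (frontier Ω) ≤ Metric.diam Ω := by
  obtain ⟨z, hz⟩ := hF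
  refine (Metric.infDist_le_dist_of_mem hz).trans ?_
  rw [← Metric.diam_closure]
  exact Metric.dist_le_diam_of_mem hΩ.closure (subset_closure hy) (frontier_subset_closure hz)

end frontier

/-! ### Growth of averages along chains -/

/-- The values of `U` at the ends of a segment in the upper half-space are compared by means of the
measure `ν`, as is the case for the smooth averages of a function with `|∇u|^p = dν`. -/
structure IsSegmentControlled {n : ℕ} (p K M : ℝ) (Ω : Set (EuclideanSpace ℝ (Fin n)))
    (U : EuclideanSpace ℝ (Fin n) → ℝ → ℝ) (ν : Measure (EuclideanSpace ℝ (Fin n))) : Prop where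
  ne_top : ∀ S : Set (EuclideanSpace ℝ (Fin n)), IsCompact S → S ⊆ Ω → ν S ≠ ⊤
  abs_sub_le : ∀ S : Set (EuclideanSpace ℝ (Fin n)), IsCompact S → S ⊆ Ω →
    ∀ (y y' z : EuclideanSpace ℝ (Fin n)) (r r' a : ℝ), 0 < a → S ⊆ Metric.closedBall z (K * a) →
      a ≤ r → a ≤ r' →
      (∀ t ∈ Set.Icc (0 : ℝ) 1,
        Metric.closedBall (y + t • (y' - y)) (r + t * (r' - r)) ⊆ S) →
      |U y' r' - U y r| ≤ M * (dist y y' + |r' - r|) * a ^ (-(n / p : ℝ)) *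
        (ν S).toReal ^ (1 / p)

lemma exists_isSegmentControlled (n : ℕ) {p : ℝ} (hp : 1 ≤ p) {K : ℝ} (hK : 0 < K) :
    ∃ M : ℝ, 0 < M ∧ ∀ (Ω : Set (EuclideanSpace ℝ (Fin n)))
      (u : EuclideanSpace ℝ (Fin n) → ℝ) (g : EuclideanSpace ℝ (Fin n) → EuclideanSpace ℝ (Fin n)),
      IsSobolevLocWith p Ω u g → IsOpen Ω → ContinuousOn u Ω →
      IsSegmentControlled p K M Ω (smoothAverage u)
        ((volume.restrict Ω).withDensity fun w => ‖g w‖ₑ ^ p) := by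
  obtain ⟨M, hM, key⟩ := exists_abs_smoothAverage_sub_le_rpow n hp hK
  refine ⟨M, hM, fun Ω u g h hΩ hu => ?_⟩
  have hν : ∀ S : Set (EuclideanSpace ℝ (Fin n)), IsCompact S → S ⊆ Ω →
      ((volume.restrict Ω).withDensity fun w => ‖g w‖ₑ ^ p) S = ∫⁻ w in S, ‖g w‖ₑ ^ p := by
    intro S hS hSΩ
    rw [withDensity_apply _ hS.measurableSet, Measure.restrict_restrict hS.measurableSet,
      Set.inter_eq_left.2 hSΩ]
  refine ⟨fun S hS hSΩ => ?_, fun S hS hSΩ => ?_⟩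
  · rw [hν S hS hSΩ]
    exact h.lintegral_rpow_ne_top hp hS hSΩ
  · rw [hν S hS hSΩ]
    exact key Ω S u g h hΩ hu hS hSΩ

section

variable {n : ℕ} {p K M α δ R : ℝ} {Ω : Set (EuclideanSpace ℝ (Fin n))}
  {U : EuclideanSpace ℝ (Fin n) → ℝ → ℝ} {ν : Measure (EuclideanSpace ℝ (Fin n))}
  {x : EuclideanSpace ℝ (Fin n)}

/-- The growth hypothesis `hν` on balls around `x`, here and below, is what
`exists_energy_lower_bound` assumes in order to refute it. -/
lemma toReal_rpow_le (hp : 1 ≤ p) (hδ : 0 ≤ δ)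
    (hν : ∀ r, 0 < r → r ≤ R → ν (Metric.closedBall x r) ≤ ENNReal.ofReal (δ * r ^ α))
    {r : ℝ} (hr : 0 < r) (hrR : r ≤ R) {S : Set (EuclideanSpace ℝ (Fin n))}
    (hS : S ⊆ Metric.closedBall x r) :
    (ν S).toReal ^ (1 / p) ≤ δ ^ (1 / p) * r ^ (α / p) := by
  have hp0 : 0 < p := by linarith
  have h1 : (ν S).toReal ≤ δ * r ^ α :=
    ENNReal.toReal_le_of_le_ofReal (by positivity) ((measure_mono hS).trans (hν r hr hrR))
  refine (Real.rpow_le_rpow ENNReal.toReal_nonneg h1 (by positivity)).trans (le_of_eq ?_)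
  rw [Real.mul_rpow hδ (by positivity), ← Real.rpow_mul hr.le, mul_one_div]

/-- A finite geometric sum of powers. -/
lemma sum_rpow_geometric_le {e m : ℝ} (he : 0 < e) (hm : 0 ≤ m) (N : ℕ) :
    ∑ j ∈ Finset.range N, (m * (1 / 2) ^ j) ^ e ≤ m ^ e * (1 - (1 / 2) ^ e)⁻¹ := by
  have hq : ((1 : ℝ) / 2) ^ e < 1 := Real.rpow_lt_one (by norm_num) (by norm_num) he
  have hq0 : 0 ≤ ((1 : ℝ) / 2) ^ e := by positivity
  have : ∀ j ∈ Finset.range N, (m * (1 / 2 : ℝ) ^ j) ^ e = m ^ e * (((1 : ℝ) / 2) ^ e) ^ j := by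
    intro j _
    rw [Real.mul_rpow hm (by positivity), ← Real.rpow_natCast, ← Real.rpow_natCast,
      ← Real.rpow_mul (by norm_num), ← Real.rpow_mul (by norm_num), mul_comm (j : ℝ)]
  rw [Finset.sum_congr rfl this, ← Finset.mul_sum]
  gcongr
  exact (summable_geometric_of_lt_one hq0 hq).sum_le_tsum _ (fun _ _ => by positivity) |>.trans
    (tsum_geometric_of_lt_one hq0 hq).le

/-- Averages over concentric shrinking balls. -/
lemma IsSegmentControlled.abs_sub_concentric_le (h : IsSegmentControlled p K M Ω U ν)
    (hp : 1 ≤ p) (hK : 2 ≤ K) (hM : 0 ≤ M) (hδ : 0 ≤ δ)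
    (hν : ∀ r, 0 < r → r ≤ R → ν (Metric.closedBall x r) ≤ ENNReal.ofReal (δ * r ^ α))
    (he : 0 < (α + p - n) / p) {r₀ : ℝ} (hr₀ : 0 < r₀) (hr₀R : r₀ ≤ R)
    (hball : Metric.closedBall x r₀ ⊆ Ω) (k : ℕ) :
    |U x r₀ - U x (r₀ * (1 / 2) ^ k)| ≤ M * (1 / 2) ^ (1 - n / p : ℝ) *
      (1 - (1 / 2) ^ ((α + p - n) / p))⁻¹ * r₀ ^ ((α + p - n) / p) * δ ^ (1 / p) := by
  have hp0 : 0 < p := by linarith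
  -- One halving costs `r^(1-n/p)` times the energy factor `r^(α/p)`; the total exponent is positive
  -- by `he`, so the halvings form a convergent geometric sum.
  have hstep : ∀ r, 0 < r → r ≤ r₀ → |U x r - U x (r * (1 / 2))| ≤
      M * (1 / 2) ^ (1 - n / p : ℝ) * δ ^ (1 / p) * r ^ ((α + p - n) / p) := by
    intro r hr hrr
    have h1 := h.abs_sub_le (Metric.closedBall x r) (isCompact_closedBall _ _)
      ((Metric.closedBall_subset_closedBall hrr).trans hball) x x x r (r * (1 / 2)) (r * (1 / 2))
      (by positivity) (Metric.closedBall_subset_closedBall (by nlinarith)) (by linarith) le_rfl ?_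
    · rw [abs_sub_comm]
      refine h1.trans ?_
      have h2 := toReal_rpow_le hp hδ hν hr (hrr.trans hr₀R) subset_rfl
      have h3 : |r * (1 / 2) - r| = r * (1 / 2) := by
        rw [abs_sub_comm, abs_of_pos (by linarith)]; ring
      rw [dist_self, zero_add, h3]
      have h4 : r * (1 / 2) * (r * (1 / 2)) ^ (-(n / p : ℝ)) * r ^ (α / p) =
          (1 / 2) ^ (1 - n / p : ℝ) * r ^ ((α + p - n) / p) := by
        have hq : 0 < r * (1 / 2) := by positivity
        have h5 : r * (1 / 2) * (r * (1 / 2)) ^ (-(n / p : ℝ)) =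
            (r * (1 / 2)) ^ (1 - n / p : ℝ) := by
          rw [sub_eq_add_neg, Real.rpow_add hq, Real.rpow_one]
        rw [h5, Real.mul_rpow hr.le (by norm_num), mul_right_comm, ← Real.rpow_add hr, mul_comm]
        congr 2
        field_simp
        ring
      calc _ ≤ M * (r * (1 / 2)) * (r * (1 / 2)) ^ (-(n / p : ℝ)) *
            (δ ^ (1 / p) * r ^ (α / p)) := by gcongr
        _ = M * (r * (1 / 2) * (r * (1 / 2)) ^ (-(n / p : ℝ)) * r ^ (α / p)) * δ ^ (1 / p) := by
            ring
        _ = _ := by rw [h4]; ring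
    · intro t ht
      rw [sub_self, smul_zero, add_zero]
      exact Metric.closedBall_subset_closedBall (by nlinarith [ht.1])
  have htel : |U x r₀ - U x (r₀ * (1 / 2) ^ k)| ≤ ∑ j ∈ Finset.range k,
      M * (1 / 2) ^ (1 - n / p : ℝ) * δ ^ (1 / p) *
        (r₀ * (1 / 2) ^ j) ^ ((α + p - n) / p) := by
    induction k with
    | zero => simp
    | succ k ih =>
      rw [Finset.sum_range_succ]
      refine (_root_.abs_sub_le _ (U x (r₀ * (1 / 2) ^ k)) _).trans (add_le_add ih ?_)
      have := hstep (r₀ * (1 / 2) ^ k) (by positivity)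
        (mul_le_of_le_one_right hr₀.le (pow_le_one₀ (by norm_num) (by norm_num)))
      rwa [mul_assoc r₀, ← pow_succ] at this
  refine htel.trans ?_
  rw [← Finset.mul_sum]
  calc _ ≤ M * (1 / 2) ^ (1 - n / p : ℝ) * δ ^ (1 / p) *
        (r₀ ^ ((α + p - n) / p) * (1 - (1 / 2) ^ ((α + p - n) / p))⁻¹) := by
        gcongr
        exact sum_rpow_geometric_le he hr₀.le k
    _ = _ := by ring

/-- Averages over consecutive balls of a chain. -/
lemma IsSegmentControlled.abs_sub_step_le (h : IsSegmentControlled p K M Ω U ν)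
    (hK : 4 ≤ K) (hM : 0 ≤ M) (hF : (frontier Ω).Nonempty) {y y' : EuclideanSpace ℝ (Fin n)}
    (hy : y ∈ Ω) (hpos : 0 < Metric.infDist y (frontier Ω))
    (hyy : dist y y' ≤ Metric.infDist y (frontier Ω) / 8) :
    |U y' (Metric.infDist y' (frontier Ω) / 8) - U y (Metric.infDist y (frontier Ω) / 8)| ≤
      M * (9 / 8) * (7 / 8) ^ (-(n / p : ℝ)) * ((Metric.infDist y (frontier Ω) / 8) *
        (Metric.infDist y (frontier Ω) / 8) ^ (-(n / p : ℝ)) *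
        (ν (Metric.closedBall y (3 * (Metric.infDist y (frontier Ω) / 8)))).toReal ^ (1 / p)) := by
  set r := Metric.infDist y (frontier Ω) / 8 with hr
  set r' := Metric.infDist y' (frontier Ω) / 8 with hr'
  have hr0 : 0 < r := by positivity
  -- The distance to the boundary is 1-Lipschitz and `r`, `r'` are eighths of it. Hence all radii on
  -- the segment lie between `7r/8` and `9r/8`, and the balls stay in the ball of radius `3r`,
  -- itself contained in `Ω`.
  have hrr : |r' - r| ≤ r / 8 := by
    have h1 := Metric.infDist_le_infDist_add_dist (x := y) (y := y') (s := frontier Ω)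
    have h2 := Metric.infDist_le_infDist_add_dist (x := y') (y := y) (s := frontier Ω)
    rw [dist_comm] at h2
    rw [abs_le]; constructor <;> linarith
  have hrr' := abs_le.1 hrr
  have h1 := h.abs_sub_le (Metric.closedBall y (3 * r)) (isCompact_closedBall _ _)
    (closedBall_subset_of_lt_infDist_frontier hF hy (by linarith)) y y' y r r' (7 / 8 * r)
    (by positivity) (Metric.closedBall_subset_closedBall (by nlinarith)) (by linarith)
    (by linarith) ?_
  · refine h1.trans ?_
    rw [Real.mul_rpow (by norm_num) hr0.le]
    calc _ ≤ M * (r + r / 8) * ((7 / 8) ^ (-(n / p : ℝ)) * r ^ (-(n / p : ℝ))) *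
          (ν (Metric.closedBall y (3 * r))).toReal ^ (1 / p) := by gcongr
      _ = _ := by ring
  · intro t ht
    refine Metric.closedBall_subset_closedBall' ?_
    have h2 : dist (y + t • (y' - y)) y ≤ r := by
      rw [dist_eq_norm, add_sub_cancel_left, norm_smul, Real.norm_of_nonneg ht.1, ← dist_eq_norm,
        dist_comm]
      exact (mul_le_of_le_one_left dist_nonneg ht.2).trans hyy
    have h3 : t * (r' - r) ≤ r / 8 := by
      nlinarith [ht.1, ht.2, mul_le_mul_of_nonneg_left hrr'.2 ht.1]
    linarith

end

section

variable {n : ℕ} {p K M α δ R s C : ℝ} {Ω : Set (EuclideanSpace ℝ (Fin n))}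
  {U : EuclideanSpace ℝ (Fin n) → ℝ → ℝ} {ν : Measure (EuclideanSpace ℝ (Fin n))}
  {x : EuclideanSpace ℝ (Fin n)}

/-- The contribution of the balls of a chain whose centers lie at arc length between `m / 2` and `m`
from the beginning of the curve. -/
lemma sum_chain_layer_le (hn : 1 ≤ n) (hp : 1 ≤ p) (hs : 0 ≤ s) (hC : 0 < C) (hδ : 0 ≤ δ)
    (hν : ∀ r, 0 < r → r ≤ R → ν (Metric.closedBall x r) ≤ ENNReal.ofReal (δ * r ^ α))
    {F : Set (EuclideanSpace ℝ (Fin n))} {c : ℕ → EuclideanSpace ℝ (Fin n)} {ℓ : ℕ → ℝ}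
    {J : Finset ℕ} {m : ℝ} (hm : 0 < m) (hmR : 5 * m ≤ R)
    (hpos : ∀ i ∈ J, 0 < Metric.infDist (c i) F)
    (hdist : ∀ i ∈ J, dist x (c i) ≤ ℓ i) (hr : ∀ i ∈ J, Metric.infDist (c i) F / 8 ≤ 9 / 8 * ℓ i)
    (hm1 : ∀ i ∈ J, m / 2 < ℓ i) (hm2 : ∀ i ∈ J, ℓ i ≤ m)
    (hJohn : ∀ i ∈ J, ℓ i ^ s ≤ C * Metric.infDist (c i) F)
    (hsum : ∑ i ∈ J, Metric.infDist (c i) F / 8 ≤ 9 / 8 * m)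
    (hsep : ∀ i ∈ J, ∀ j ∈ J, i < j → Metric.infDist (c i) F / 8 ≤ dist (c i) (c j)) :
    ∑ i ∈ J, (Metric.infDist (c i) F / 8) * (Metric.infDist (c i) F / 8) ^ (-(n / p : ℝ)) *
        (ν (Metric.closedBall (c i) (3 * (Metric.infDist (c i) F / 8)))).toReal ^ (1 / p) ≤
      (9 / 8) ^ (1 - p⁻¹) * (((1 / 2) ^ s / (8 * C)) ^ (1 - n : ℝ) * 22 ^ n * 5 ^ α) ^ p⁻¹ *
        δ ^ (1 / p) * m ^ ((p - 1 + α - s * (n - 1)) / p) := by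
  have hp0 : 0 < p := by linarith
  set r : ℕ → ℝ := fun i => Metric.infDist (c i) F / 8 with hrdef
  set I : ℕ → ℝ := fun i => (ν (Metric.closedBall (c i) (3 * r i))).toReal with hI
  have hr0 : ∀ i, 0 ≤ r i := fun i => div_nonneg Metric.infDist_nonneg (by norm_num)
  have hI0 : ∀ i, 0 ≤ I i := fun i => ENNReal.toReal_nonneg
  have hrpos : ∀ i ∈ J, 0 < r i := fun i hi => div_pos (hpos i hi) (by norm_num)
  set b : ℝ := (1 / 2) ^ s / (8 * C) with hb
  have hb0 : 0 < b := by positivity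
  -- The factor `r i` is kept apart as the weight in Hölder's inequality, because the sum of the
  -- radii is controlled.
  have hterm : ∀ i, r i * r i ^ (-(n / p : ℝ)) * I i ^ (1 / p) =
      r i * (r i ^ (-(n : ℝ)) * I i) ^ p⁻¹ := by
    intro i
    rw [Real.mul_rpow (Real.rpow_nonneg (hr0 i) _) (hI0 i), ← Real.rpow_mul (hr0 i), one_div,
      ← mul_assoc]
    congr 3
    ring
  change ∑ i ∈ J, r i * r i ^ (-(n / p : ℝ)) * I i ^ (1 / p) ≤ _
  rw [Finset.sum_congr rfl fun i _ => hterm i]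
  refine (Real.inner_le_weight_mul_Lp_of_nonneg J hp r _ hr0
    fun i => Real.rpow_nonneg (mul_nonneg (Real.rpow_nonneg (hr0 i) _) (hI0 i)) _).trans ?_
  -- The center is within `m` of `x` and the radius is at most `27m/8`.
  have hsub : ∀ i ∈ J, Metric.closedBall (c i) (3 * r i) ⊆ Metric.closedBall x (5 * m) := by
    intro i hi
    refine Metric.closedBall_subset_closedBall' ?_
    have h1 := hdist i hi
    have h2 := hr i hi
    have h3 := hm2 i hi
    rw [dist_comm] at h1
    change 3 * (Metric.infDist (c i) F / 8) + _ ≤ _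
    linarith
  have hsumI : ∑ i ∈ J, I i ≤ 22 ^ n * (δ * (5 * m) ^ α) := by
    have h1 := sum_measure_closedBall_le hpos hsep ν
      (measurableSet_closedBall (x := x) (ε := 5 * m)) hsub
    have h2 : 22 ^ n * ν (Metric.closedBall x (5 * m)) ≤
        ENNReal.ofReal (22 ^ n * (δ * (5 * m) ^ α)) := by
      rw [ENNReal.ofReal_mul (by positivity), ENNReal.ofReal_pow (by norm_num)]
      norm_num
      gcongr
      exact hν _ (by positivity) hmR
    have h3 := h1.trans h2
    have h4 : ∀ i ∈ J, ν (Metric.closedBall (c i) (3 * r i)) ≠ ⊤ := fun i hi =>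
      ne_top_of_le_ne_top ENNReal.ofReal_ne_top
        ((measure_mono (hsub i hi)).trans (hν _ (by positivity) hmR))
    rw [hI, ← ENNReal.toReal_sum h4]
    exact ENNReal.toReal_le_of_le_ofReal (by positivity) h3
  have hlow : ∀ i ∈ J, b * m ^ s ≤ r i := by
    intro i hi
    have h1 : (m / 2) ^ s ≤ C * Metric.infDist (c i) F :=
      (Real.rpow_le_rpow (by positivity) (hm1 i hi).le hs).trans (hJohn i hi)
    rw [div_eq_mul_one_div, Real.mul_rpow hm.le (by norm_num)] at h1
    change (1 / 2) ^ s / (8 * C) * m ^ s ≤ Metric.infDist (c i) F / 8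
    rw [div_mul_eq_mul_div, div_le_div_iff₀ (by positivity) (by norm_num)]
    linarith
  have hsum2 : ∑ i ∈ J, r i * ((r i ^ (-(n : ℝ)) * I i) ^ p⁻¹) ^ p ≤
      (b * m ^ s) ^ (1 - n : ℝ) * (22 ^ n * (δ * (5 * m) ^ α)) := by
    calc _ = ∑ i ∈ J, r i ^ (1 - n : ℝ) * I i := by
          refine Finset.sum_congr rfl fun i hi => ?_
          rw [Real.rpow_inv_rpow (mul_nonneg (Real.rpow_nonneg (hr0 i) _) (hI0 i)) hp0.ne',
            ← mul_assoc, sub_eq_add_neg, Real.rpow_add (hrpos i hi), Real.rpow_one]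
      _ ≤ ∑ i ∈ J, (b * m ^ s) ^ (1 - n : ℝ) * I i := by
          refine Finset.sum_le_sum fun i hi => mul_le_mul_of_nonneg_right ?_ (hI0 i)
          refine Real.rpow_le_rpow_of_nonpos (by positivity) (hlow i hi) ?_
          have : (1 : ℝ) ≤ n := by exact_mod_cast hn
          linarith
      _ ≤ _ := by
          rw [← Finset.mul_sum]
          gcongr
  have hexp : 0 ≤ 1 - p⁻¹ := by
    rw [sub_nonneg]; exact inv_le_one_of_one_le₀ hp
  calc _ ≤ (9 / 8 * m) ^ (1 - p⁻¹) *
        ((b * m ^ s) ^ (1 - n : ℝ) * (22 ^ n * (δ * (5 * m) ^ α))) ^ p⁻¹ := by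
        refine mul_le_mul (Real.rpow_le_rpow (Finset.sum_nonneg fun i _ => hr0 i) hsum hexp)
          (Real.rpow_le_rpow (Finset.sum_nonneg fun i _ => mul_nonneg (hr0 i)
            (Real.rpow_nonneg (Real.rpow_nonneg
              (mul_nonneg (Real.rpow_nonneg (hr0 i) _) (hI0 i)) _) _)) hsum2 (by positivity))
          (Real.rpow_nonneg (Finset.sum_nonneg fun i _ => mul_nonneg (hr0 i)
            (Real.rpow_nonneg (Real.rpow_nonneg
              (mul_nonneg (Real.rpow_nonneg (hr0 i) _) (hI0 i)) _) _)) _) (by positivity)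
    _ = (9 / 8) ^ (1 - p⁻¹) * m ^ (1 - p⁻¹) *
        ((b ^ (1 - n : ℝ) * 22 ^ n * 5 ^ α) * δ * (m ^ (s * (1 - n : ℝ)) * m ^ α)) ^ p⁻¹ := by
        rw [Real.mul_rpow (by norm_num) hm.le, Real.mul_rpow hb0.le (by positivity),
          ← Real.rpow_mul hm.le, Real.mul_rpow (by norm_num : (0 : ℝ) ≤ 5) hm.le]
        congr 2
        ring
    _ = (9 / 8) ^ (1 - p⁻¹) * (b ^ (1 - n : ℝ) * 22 ^ n * 5 ^ α) ^ p⁻¹ * δ ^ (1 / p) *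
        (m ^ (1 - p⁻¹) * (m ^ (s * (1 - n : ℝ) + α)) ^ p⁻¹) := by
        rw [← Real.rpow_add hm, Real.mul_rpow (by positivity) (by positivity),
          Real.mul_rpow (by positivity) hδ, one_div]
        ring
    _ = _ := by
        rw [← Real.rpow_mul hm.le, ← Real.rpow_add hm]
        congr 2
        field_simp
        ring

/-- Averages over the first and the last ball of a chain. -/
lemma IsSegmentControlled.abs_sub_chain_le (h : IsSegmentControlled p K M Ω U ν)
    (hn : 1 ≤ n) (hp : 1 ≤ p) (hs : 0 < s) (hC : 0 < C) (hδ : 0 ≤ δ) (hK : 4 ≤ K) (hM : 0 ≤ M)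
    (hν : ∀ r, 0 < r → r ≤ R → ν (Metric.closedBall x r) ≤ ENNReal.ofReal (δ * r ^ α))
    (hF : (frontier Ω).Nonempty) (hpos : ∀ y ∈ Ω, 0 < Metric.infDist y (frontier Ω))
    (he : 0 < (α + p - n) / p) (he' : 0 < (p - 1 + α - s * (n - 1)) / p)
    {L D : ℝ} (hL : 0 < L) (hLR : 5 * L ≤ R) (hDR : D ≤ R)
    (hd : ∀ y ∈ Ω, Metric.infDist y (frontier Ω) ≤ D) (hLD : C * D ≤ L ^ s)
    {N : ℕ} {c : ℕ → EuclideanSpace ℝ (Fin n)} {ℓ : ℕ → ℝ} (hN : 0 < N) (hc0 : c 0 = x)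
    (hc : ∀ k, c k ∈ Ω) (hℓ0 : ℓ 0 = 0)
    (hℓ : ∀ k, dist (c k) (c (k + 1)) ≤ ℓ (k + 1) - ℓ k)
    (hJohn : ∀ k, ℓ k ^ s ≤ C * Metric.infDist (c k) (frontier Ω))
    (hstep : ∀ k, dist (c k) (c (k + 1)) ≤ Metric.infDist (c k) (frontier Ω) / 8)
    (hsep : ∀ i j, i < j → j < N → Metric.infDist (c i) (frontier Ω) / 8 ≤ dist (c i) (c j)) :
    |U x (Metric.infDist x (frontier Ω) / 8) - U (c N) (Metric.infDist (c N) (frontier Ω) / 8)| ≤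
      M * (9 / 8) * (7 / 8) ^ (-(n / p : ℝ)) * (3 ^ (α / p) * D ^ ((α + p - n) / p) +
        (9 / 8) ^ (1 - p⁻¹) * (((1 / 2) ^ s / (8 * C)) ^ (1 - n : ℝ) * 22 ^ n * 5 ^ α) ^ p⁻¹ *
        (L ^ ((p - 1 + α - s * (n - 1)) / p) *
          (1 - (1 / 2) ^ ((p - 1 + α - s * (n - 1)) / p))⁻¹)) * δ ^ (1 / p) := by
  have hp0 : 0 < p := by linarith
  set d : ℕ → ℝ := fun i => Metric.infDist (c i) (frontier Ω) with hddef
  have hd0 : ∀ i, 0 < d i := fun i => hpos _ (hc i)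
  set f : ℕ → ℝ := fun i => (d i / 8) * (d i / 8) ^ (-(n / p : ℝ)) *
    (ν (Metric.closedBall (c i) (3 * (d i / 8)))).toReal ^ (1 / p) with hf
  have hf0 : ∀ i, 0 ≤ f i := fun i => by have := hd0 i; positivity
  set A : ℝ := M * (9 / 8) * (7 / 8) ^ (-(n / p : ℝ)) with hA
  have hmono : Monotone ℓ := monotone_nat_of_le_succ fun k => by
    linarith [hℓ k, dist_nonneg (x := c k) (y := c (k + 1))]
  have hdist0 : ∀ k, dist x (c k) ≤ ℓ k := by
    intro k
    induction k with
    | zero => simp [hc0, hℓ0]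
    | succ k ih => linarith [dist_triangle x (c k) (c (k + 1)), hℓ k]
  have htel : |U x (Metric.infDist x (frontier Ω) / 8) - U (c N) (d N / 8)| ≤
      A * ∑ i ∈ Finset.range N, f i := by
    have : ∀ k, |U x (Metric.infDist x (frontier Ω) / 8) - U (c k) (d k / 8)| ≤
        A * ∑ i ∈ Finset.range k, f i := by
      intro k
      induction k with
      | zero => simp [hddef, hc0]
      | succ k ih =>
        rw [Finset.sum_range_succ, mul_add]
        refine (_root_.abs_sub_le _ (U (c k) (d k / 8)) _).trans (add_le_add ih ?_)
        rw [abs_sub_comm]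
        exact h.abs_sub_step_le hK hM hF (hc k) (hd0 k) (hstep k)
    exact this N
  -- The first ball has arc length 0 and belongs to no dyadic layer; being centered at `x`, it is
  -- handled by the growth hypothesis alone.
  have hf_zero : f 0 ≤ 3 ^ (α / p) * D ^ ((α + p - n) / p) * δ ^ (1 / p) := by
    have hd0' := hd0 0
    have hdD : d 0 ≤ D := hd _ (hc 0)
    have h1 := toReal_rpow_le hp hδ hν (r := 3 * (d 0 / 8)) (by positivity) (by linarith)
      (S := Metric.closedBall (c 0) (3 * (d 0 / 8))) (by rw [hc0])
    calc f 0 ≤ (d 0 / 8) * (d 0 / 8) ^ (-(n / p : ℝ)) *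
          (δ ^ (1 / p) * (3 * (d 0 / 8)) ^ (α / p)) := by
          simp only [hf]; gcongr
      _ = 3 ^ (α / p) * (d 0 / 8) ^ ((α + p - n) / p) * δ ^ (1 / p) := by
          have h2 : (d 0 / 8) ^ ((α + p - n) / p) =
              (d 0 / 8) * (d 0 / 8) ^ (-(n / p : ℝ)) * (d 0 / 8) ^ (α / p) := by
            have : (α + p - n) / p = 1 + -(n / p : ℝ) + α / p := by field_simp; ring
            rw [this, Real.rpow_add (by positivity), Real.rpow_add (by positivity), Real.rpow_one]
          rw [h2, Real.mul_rpow (by norm_num) (by positivity)]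
          ring
      _ ≤ _ := by
          gcongr
          linarith
  have hlayers : ∑ i ∈ Finset.Ico 1 N, f i ≤
      (9 / 8) ^ (1 - p⁻¹) * (((1 / 2) ^ s / (8 * C)) ^ (1 - n : ℝ) * 22 ^ n * 5 ^ α) ^ p⁻¹ *
        (L ^ ((p - 1 + α - s * (n - 1)) / p) *
          (1 - (1 / 2) ^ ((p - 1 + α - s * (n - 1)) / p))⁻¹) * δ ^ (1 / p) := by
    have hℓ1 : ∀ i ∈ Finset.Ico 1 N, d 0 / 8 ≤ ℓ i := by
      intro i hi
      rw [Finset.mem_Ico] at hi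
      have := hsep 0 i (by lia) hi.2
      rw [hc0] at this
      simp only [hddef, hc0]
      exact this.trans (hdist0 i)
    -- The John condition bounds the length, since the distance to the boundary is at most `D`.
    have hℓL : ∀ i, ℓ i ≤ L := by
      intro i
      have h0 : 0 ≤ ℓ i := hℓ0 ▸ hmono (Nat.zero_le i)
      refine (Real.rpow_le_rpow_iff h0 hL.le hs).1 ((hJohn i).trans (le_trans ?_ hLD))
      exact mul_le_mul_of_nonneg_left (hd _ (hc i)) hC.le
    have hex : ∀ i, ∃ j : ℕ, i ∈ Finset.Ico 1 N →
        L * (1 / 2) ^ j / 2 < ℓ i ∧ ℓ i ≤ L * (1 / 2) ^ j := by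
      intro i
      by_cases hi : i ∈ Finset.Ico 1 N
      · have hpos_i : 0 < ℓ i := lt_of_lt_of_le (by linarith [hd0 0]) (hℓ1 i hi)
        obtain ⟨j, hj1, hj2⟩ := exists_nat_pow_near_of_lt_one (x := ℓ i / L) (y := 1 / 2)
          (by positivity) ((div_le_one hL).2 (hℓL i)) (by norm_num) (by norm_num)
        rw [lt_div_iff₀ hL] at hj1
        rw [div_le_iff₀ hL] at hj2
        exact ⟨j, fun _ => ⟨by rw [pow_succ] at hj1; linarith, by linarith⟩⟩
      · exact ⟨0, fun h => absurd h hi⟩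
    choose κ hκ using hex
    obtain ⟨T, hT⟩ : ∃ T, ∀ i ∈ Finset.Ico 1 N, κ i ∈ Finset.range T :=
      ⟨(Finset.Ico 1 N).sup κ + 1, fun i hi => Finset.mem_range.2
        (Nat.lt_succ_of_le (Finset.le_sup hi))⟩
    rw [← Finset.sum_fiberwise_of_maps_to hT]
    set B : ℝ := (9 / 8) ^ (1 - p⁻¹) *
      (((1 / 2) ^ s / (8 * C)) ^ (1 - n : ℝ) * 22 ^ n * 5 ^ α) ^ p⁻¹ with hB
    have hlayer : ∀ j ∈ Finset.range T, ∑ i ∈ Finset.Ico 1 N with κ i = j, f i ≤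
        B * δ ^ (1 / p) * (L * (1 / 2) ^ j) ^ ((p - 1 + α - s * (n - 1)) / p) := by
      intro j _
      set J := (Finset.Ico 1 N).filter fun i => κ i = j with hJ
      have hJ1 : ∀ i ∈ J, i ∈ Finset.Ico 1 N := fun i hi => (Finset.mem_filter.1 hi).1
      have hJ2 : ∀ i ∈ J, L * (1 / 2) ^ j / 2 < ℓ i ∧ ℓ i ≤ L * (1 / 2) ^ j := fun i hi => by
        have := hκ i (hJ1 i hi)
        rwa [(Finset.mem_filter.1 hi).2] at this
      have hm0 : 0 < L * (1 / 2) ^ j := by positivity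
      have hmL : L * (1 / 2) ^ j ≤ L :=
        mul_le_of_le_one_right hL.le (pow_le_one₀ (by norm_num) (by norm_num))
      refine sum_chain_layer_le (x := x) (ℓ := ℓ) hn hp hs.le hC hδ hν hm0 (by linarith)
        (fun i _ => hd0 i) (fun i _ => hdist0 i) (fun i hi => ?_) (fun i hi => (hJ2 i hi).1)
        (fun i hi => (hJ2 i hi).2) (fun i _ => hJohn i) ?_
        (fun i _ k hk hik => hsep i k hik (Finset.mem_Ico.1 (hJ1 k hk)).2)
      -- Moving from `x` to `c i` increases the radius by at most `ℓ i / 8`, and the first radius is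
      -- itself at most `ℓ i`.
      · have h1 := hℓ1 i (hJ1 i hi)
        have h2 := Metric.infDist_le_infDist_add_dist (x := c i) (y := x) (s := frontier Ω)
        rw [dist_comm] at h2
        have h3 := hdist0 i
        simp only [hddef, hc0] at h1
        linarith
      -- Each radius is charged to the preceding step, which separation makes at least as long as
      -- the preceding radius. The following step would not do: the last one, ending at `c N`, may
      -- be short.
      · calc ∑ i ∈ J, d i / 8 ≤ ∑ i ∈ J, 9 / 8 * (ℓ (i - 1 + 1) - ℓ (i - 1)) := by
              refine Finset.sum_le_sum fun i hi => ?_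
              obtain ⟨hi1, hi2⟩ := Finset.mem_Ico.1 (hJ1 i hi)
              obtain ⟨k, rfl⟩ := Nat.exists_eq_add_of_le' hi1
              rw [Nat.add_sub_cancel]
              have h1 := hsep k (k + 1) (Nat.lt_succ_self k) hi2
              have h2 := hstep k
              have h3 := hℓ k
              have h4 := Metric.infDist_le_infDist_add_dist (x := c (k + 1)) (y := c k)
                (s := frontier Ω)
              rw [dist_comm] at h4
              simp only [hddef]
              linarith
          _ = 9 / 8 * ∑ k ∈ J.image fun i => i - 1, (ℓ (k + 1) - ℓ k) := by
              rw [← Finset.mul_sum, Finset.sum_image]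
              intro i hi k hk hik
              have h1 := (Finset.mem_Ico.1 (hJ1 i hi)).1
              have h2 := (Finset.mem_Ico.1 (hJ1 k hk)).1
              simp only at hik
              lia
          _ ≤ 9 / 8 * ∑ k ∈ Finset.range N with ℓ (k + 1) ≤ L * (1 / 2) ^ j,
                (ℓ (k + 1) - ℓ k) := by
              refine mul_le_mul_of_nonneg_left (Finset.sum_le_sum_of_subset_of_nonneg ?_
                fun k _ _ => sub_nonneg.2 (hmono (Nat.le_succ k))) (by norm_num)
              intro k hk
              obtain ⟨i, hi, rfl⟩ := Finset.mem_image.1 hk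
              obtain ⟨hi1, hi2⟩ := Finset.mem_Ico.1 (hJ1 i hi)
              rw [Finset.mem_filter, Finset.mem_range, Nat.sub_add_cancel hi1]
              exact ⟨by lia, (hJ2 i hi).2⟩
          _ ≤ _ := mul_le_mul_of_nonneg_left (sum_increments_le hℓ0 hmono hm0.le N) (by norm_num)
    refine (Finset.sum_le_sum hlayer).trans ?_
    rw [← Finset.mul_sum]
    calc _ ≤ B * δ ^ (1 / p) * (L ^ ((p - 1 + α - s * (n - 1)) / p) *
          (1 - (1 / 2) ^ ((p - 1 + α - s * (n - 1)) / p))⁻¹) := by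
          gcongr
          exact sum_rpow_geometric_le he' hL.le T
      _ = _ := by ring
  refine htel.trans ?_
  rw [mul_assoc A]
  refine mul_le_mul_of_nonneg_left ?_ (by positivity)
  rw [Finset.range_eq_Ico, Finset.sum_eq_sum_Ico_succ_bot hN, add_mul]
  exact add_le_add hf_zero hlayers

end

/-! ### The central cube -/

lemma IsClosedCube.exists_center {n : ℕ} (hn : 1 ≤ n) {Q : Set (EuclideanSpace ℝ (Fin n))}
    (hQ : IsClosedCube Q) : Convex ℝ Q ∧ IsCompact Q ∧ ∃ (y : EuclideanSpace ℝ (Fin n)) (l : ℝ),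
      0 < l ∧ Metric.closedBall y (l / 2) ⊆ Q ∧ Metric.diam Q ≤ n * l ∧ l ≤ Metric.diam Q := by
  obtain ⟨a, l, hl, rfl⟩ := hQ
  have hdist : ∀ x ∈ {x : EuclideanSpace ℝ (Fin n) | ∀ i, x i ∈ Set.Icc (a i) (a i + l)},
      ∀ y ∈ {x : EuclideanSpace ℝ (Fin n) | ∀ i, x i ∈ Set.Icc (a i) (a i + l)},
      dist x y ≤ n * l := by
    intro x hx y hy
    rw [EuclideanSpace.dist_eq]
    refine Real.sqrt_le_iff.2 ⟨by positivity, ?_⟩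
    calc ∑ i, dist (x i) (y i) ^ 2 ≤ ∑ _i : Fin n, l ^ 2 := by
          refine Finset.sum_le_sum fun i _ => ?_
          have h1 := hx i
          have h2 := hy i
          have : dist (x i) (y i) ≤ l := by
            rw [Real.dist_eq, abs_le]
            constructor <;> linarith [h1.1, h1.2, h2.1, h2.2]
          gcongr
      _ = n * l ^ 2 := by simp
      _ ≤ (n * l) ^ 2 := by
          have : (1 : ℝ) ≤ n := by exact_mod_cast hn
          nlinarith [mul_le_mul_of_nonneg_right this (by positivity : (0 : ℝ) ≤ n * l ^ 2)]
  have hbdd : Bornology.IsBounded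
      {x : EuclideanSpace ℝ (Fin n) | ∀ i, x i ∈ Set.Icc (a i) (a i + l)} :=
    Metric.isBounded_iff.2 ⟨_, fun x hx y hy => hdist x hx y hy⟩
  refine ⟨?_, ?_, WithLp.toLp 2 fun i => a i + l / 2, l, hl, ?_,
    Metric.diam_le_of_forall_dist_le (by positivity) hdist, ?_⟩
  · intro x hx y hy s t hs ht hst i
    have := convex_Icc (𝕜 := ℝ) (a i) (a i + l) (hx i) (hy i) hs ht hst
    simpa using this
  · refine Metric.isCompact_of_isClosed_isBounded ?_ hbdd
    simp only [Set.ofPred_forall]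
    exact isClosed_iInter fun i => isClosed_Icc.preimage
      (EuclideanSpace.proj i : _ →L[ℝ] ℝ).continuous
  · intro w hw i
    rw [Metric.mem_closedBall, dist_eq_norm] at hw
    have := (PiLp.norm_apply_le _ i).trans hw
    simp only [PiLp.sub_apply, Real.norm_eq_abs] at this
    have := abs_le.1 this
    constructor <;> linarith
  · have h1 : a ∈ {x : EuclideanSpace ℝ (Fin n) | ∀ i, x i ∈ Set.Icc (a i) (a i + l)} :=
      fun i => ⟨le_rfl, by linarith⟩
    have h2 : a + EuclideanSpace.single ⟨0, hn⟩ l ∈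
        {x : EuclideanSpace ℝ (Fin n) | ∀ i, x i ∈ Set.Icc (a i) (a i + l)} := by
      intro i
      rw [PiLp.add_apply, PiLp.single_apply]
      split_ifs <;> constructor <;> linarith
    have := Metric.dist_le_diam_of_mem hbdd h1 h2
    rwa [dist_self_add_right, PiLp.norm_single, Real.norm_of_nonneg hl.le] at this

/-! ### Comparing the distance of a set with that of its points -/

section setDist

variable {X : Type*} [PseudoMetricSpace X] {A B : Set X}

lemma setDist_le_infDist (hB : B.Nonempty) {x : X} (hx : x ∈ A) :
    setDist A B ≤ Metric.infDist x B := by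
  rw [Metric.le_infDist hB]
  have hbdd : BddBelow (Set.image2 dist A B) :=
    ⟨0, by rintro _ ⟨_, _, _, _, rfl⟩; exact dist_nonneg⟩
  exact fun y hy => csInf_le hbdd (Set.mem_image2_of_mem hx hy)

lemma infDist_le_setDist_add_diam (hA : Bornology.IsBounded A) (hB : B.Nonempty) {x : X}
    (hx : x ∈ A) : Metric.infDist x B ≤ setDist A B + Metric.diam A := by
  rw [← sub_le_iff_le_add]
  refine le_csInf (Set.Nonempty.image2 ⟨x, hx⟩ hB) ?_
  rintro _ ⟨y, hy, z, hz, rfl⟩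
  have h1 := Metric.infDist_le_dist_of_mem (x := x) hz
  have h2 := Metric.dist_le_diam_of_mem hA hx hy
  linarith [dist_triangle x y z]

end setDist

/-- Averages around a point of a central cube and over a ball inside that cube. -/
lemma IsSegmentControlled.abs_sub_cube_le {n : ℕ} {p M α δ R : ℝ}
    {Ω : Set (EuclideanSpace ℝ (Fin n))} {U : EuclideanSpace ℝ (Fin n) → ℝ → ℝ}
    {ν : Measure (EuclideanSpace ℝ (Fin n))} {x : EuclideanSpace ℝ (Fin n)}
    (h : IsSegmentControlled p (16 * n) M Ω U ν) (hn : 1 ≤ n) (hp : 1 ≤ p) (hM : 0 ≤ M)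
    (hδ : 0 ≤ δ)
    (hν : ∀ r, 0 < r → r ≤ R → ν (Metric.closedBall x r) ≤ ENNReal.ofReal (δ * r ^ α))
    (hR : 0 < R) (hΩR : Ω ⊆ Metric.closedBall x R) (hF : (frontier Ω).Nonempty)
    {Q : Set (EuclideanSpace ℝ (Fin n))} (hQΩ : Q ⊆ Ω) (hconv : Convex ℝ Q) (hcomp : IsCompact Q)
    (hdiam : Metric.diam Q ≤ setDist Q (frontier Ω))
    (hdiam' : setDist Q (frontier Ω) ≤ 4 * Metric.diam Q)
    {x₀ y₀ : EuclideanSpace ℝ (Fin n)} (hx₀ : x₀ ∈ Q) (hy₀ : y₀ ∈ Q) {l m₀ D : ℝ} (hl : 0 < l)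
    (hl1 : Metric.diam Q ≤ n * l) (hl2 : l ≤ Metric.diam Q) (hm₀ : 0 < m₀)
    (hmQ : m₀ ≤ Metric.diam Q) (hQD : Metric.diam Q ≤ D) :
    |U y₀ (l / 2) - U x₀ (Metric.infDist x₀ (frontier Ω) / 8)| ≤
      2 * M * D * (m₀ / (8 * n)) ^ (-(n / p : ℝ)) * R ^ (α / p) * δ ^ (1 / p) := by
  have hp0 : 0 < p := by linarith
  have hn0 : (1 : ℝ) ≤ n := by exact_mod_cast hn
  set d := Metric.diam Q with hd
  have hd0 : 0 < d := hl.trans_le hl2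
  have hdist : ∀ y ∈ Q, d ≤ Metric.infDist y (frontier Ω) := fun y hy =>
    hdiam.trans (setDist_le_infDist hF hy)
  set r := Metric.infDist x₀ (frontier Ω) / 8 with hr
  have hr1 : d / 8 ≤ r := by have := hdist x₀ hx₀; simp only [hr]; linarith
  have hr2 : r ≤ 5 / 8 * d := by
    have := infDist_le_setDist_add_diam hcomp.isBounded hF hx₀
    simp only [hr]; linarith
  -- Both radii, `r ≤ 5d/8` and `l / 2 ≤ d/2`, are below `3d/4`, which is less than the distance `d`
  -- available to the boundary. So by convexity of `Q` one compact set contains all balls along the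
  -- segment.
  set S := Metric.cthickening (3 / 4 * d) Q with hS
  have hScomp : IsCompact S := hcomp.cthickening
  have hSeq : S = ⋃ y ∈ Q, Metric.closedBall y (3 / 4 * d) :=
    hcomp.cthickening_eq_biUnion_closedBall (by positivity)
  have hSΩ : S ⊆ Ω := by
    rw [hSeq]
    exact Set.iUnion₂_subset fun y hy => closedBall_subset_of_lt_infDist_frontier hF (hQΩ hy)
      (lt_of_lt_of_le (by linarith) (hdist y hy))
  have ha : d / (8 * n) ≤ d / 8 := by
    apply div_le_div_of_nonneg_left hd0.le (by norm_num); linarith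
  have ha2 : d / (8 * n) ≤ l / 2 := by
    rw [div_le_div_iff₀ (by positivity) (by norm_num)]; nlinarith
  have hSball : S ⊆ Metric.closedBall x₀ (16 * n * (d / (8 * n))) := by
    -- This fixes the parameter `K = 16 n`: a ball of radius `2d` around `x₀` contains the thickened
    -- cube.
    have : 16 * n * (d / (8 * n)) = 2 * d := by field_simp; ring
    rw [this, hSeq]
    refine Set.iUnion₂_subset fun y hy => Metric.closedBall_subset_closedBall' ?_
    linarith [Metric.dist_le_diam_of_mem hcomp.isBounded hy hx₀]
  have h1 := h.abs_sub_le S hScomp hSΩ x₀ y₀ x₀ r (l / 2) (d / (8 * n)) (by positivity) hSball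
    (ha.trans hr1) ha2 ?_
  · refine h1.trans ?_
    have h2 := toReal_rpow_le hp hδ hν hR le_rfl (hSΩ.trans hΩR)
    have h3 : dist x₀ y₀ + |l / 2 - r| ≤ 2 * D := by
      have h4 := Metric.dist_le_diam_of_mem hcomp.isBounded hx₀ hy₀
      have h5 : |l / 2 - r| ≤ d := by rw [abs_le]; constructor <;> linarith
      linarith
    have h4 : (d / (8 * n)) ^ (-(n / p : ℝ)) ≤ (m₀ / (8 * n)) ^ (-(n / p : ℝ)) := by
      refine Real.rpow_le_rpow_of_nonpos (by positivity) (by gcongr) ?_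
      rw [Left.neg_nonpos_iff]; positivity
    calc _ ≤ M * (2 * D) * (m₀ / (8 * n)) ^ (-(n / p : ℝ)) * (δ ^ (1 / p) * R ^ (α / p)) := by
          have : 0 ≤ D := hd0.le.trans hQD
          gcongr
      _ = _ := by ring
  · intro t ht
    refine (Metric.closedBall_subset_closedBall ?_).trans
      (Metric.closedBall_subset_cthickening (hconv.add_smul_sub_mem hx₀ hy₀ ht) _)
    nlinarith [mul_nonneg ht.1 (by linarith : (0 : ℝ) ≤ 3 / 4 * d - l / 2),
      mul_nonneg (sub_nonneg.2 ht.2) (by linarith : (0 : ℝ) ≤ 3 / 4 * d - r)]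

/-! ### The pointwise estimate -/

/-- Some point of `Ω` is farther than a quarter of the diameter from `x₀`; its John curve is at
least that long, and the condition is read off at `t = 1`. This bounds the size of the central cube
from below and forces `C` to be positive. -/
lemma IsSJohnDomain.rpow_le {n : ℕ} {s C : ℝ} {Ω : Set (EuclideanSpace ℝ (Fin n))}
    {x₀ : EuclideanSpace ℝ (Fin n)} (h : IsSJohnDomain s C Ω x₀) (hs : 0 ≤ s)
    (hD : 0 < Metric.diam Ω) :
    (Metric.diam Ω / 4) ^ s ≤ C * Metric.infDist x₀ (frontier Ω) := by
  obtain ⟨x, hx, hdist⟩ : ∃ x ∈ Ω, Metric.diam Ω / 4 < dist x x₀ := by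
    by_contra! hle
    have := Metric.diam_le_of_subset_closedBall (by positivity) hle
    linarith
  obtain ⟨γ, hγ⟩ := h.exists_curve x hx
  have h1 := hγ.twisted 1 ⟨one_pos, le_rfl⟩
  rw [hγ.target] at h1
  refine (Real.rpow_le_rpow (by positivity) ?_ hs).trans h1
  have h2 := ENNReal.toReal_mono hγ.rectifiable (eVariationOn.edist_le γ
    (Set.left_mem_Icc.2 zero_le_one) (Set.right_mem_Icc.2 zero_le_one))
  rw [← dist_edist, hγ.source, hγ.target] at h2
  exact hdist.le.trans h2

/-- Around every point at which an admissible function is nonpositive there is a ball in which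
the function has large energy. -/
lemma exists_energy_lower_bound {n : ℕ} (hn : 1 ≤ n) {s p ε CJ D : ℝ} (hs : 1 ≤ s) (hε : 0 < ε)
    (hp : 1 ≤ p) (hCJ : 0 < CJ) (hD : 0 < D) :
    ∃ δ R : ℝ, 0 < δ ∧ 0 < R ∧
      ∀ (Ω : Set (EuclideanSpace ℝ (Fin n))) (x₀ : EuclideanSpace ℝ (Fin n)),
        IsSJohnDomain s CJ Ω x₀ → Metric.diam Ω = D →
        ∀ Q ⊆ Ω, IsClosedCube Q → x₀ ∈ Q → Metric.diam Q ≤ setDist Q (frontier Ω) →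
        setDist Q (frontier Ω) ≤ 4 * Metric.diam Q →
        ∀ (u : EuclideanSpace ℝ (Fin n) → ℝ)
          (g : EuclideanSpace ℝ (Fin n) → EuclideanSpace ℝ (Fin n)),
          ContinuousOn u Ω → IsSobolevLocWith p Ω u g → (∀ y ∈ Q, 1 ≤ u y) →
          ∀ x ∈ Ω, u x ≤ 0 → ∃ r, 0 < r ∧ r ≤ R ∧
            ENNReal.ofReal (δ * r ^ (s * (n - 1) + 1 - p + ε)) ≤
              ((volume.restrict Ω).withDensity fun w => ‖g w‖ₑ ^ p) (Metric.closedBall x r) := by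
  have hp0 : 0 < p := by linarith
  have hs0 : 0 < s := by linarith
  have hn1 : (1 : ℝ) ≤ n := by exact_mod_cast hn
  obtain ⟨M, hM, hseg⟩ := exists_isSegmentControlled n hp (K := 16 * n) (by positivity)
  set α := s * (n - 1) + 1 - p + ε with hα
  set e := (α + p - n) / p with he_def
  set e' := (p - 1 + α - s * (n - 1)) / p with he'_def
  -- Here `α + p - n = (s - 1)(n - 1) + ε`, and in `he'` the numerator is exactly `ε`.
  have he : 0 < e := by
    refine div_pos ?_ hp0
    have : 0 ≤ (s - 1) * (n - 1) := mul_nonneg (by linarith) (by linarith)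
    simp only [hα]; linarith
  have he' : 0 < e' := div_pos (by simp only [hα]; linarith) hp0
  set L := (CJ * D) ^ s⁻¹ with hL_def
  have hL : 0 < L := by positivity
  have hLs : L ^ s = CJ * D := Real.rpow_inv_rpow (by positivity) hs0.ne'
  -- `5 * L` covers the balls of radius `5m` used for the layers with `m ≤ L`, and `D` makes the
  -- ball around `x` contain `Ω`.
  set R := 5 * L + D with hR_def
  have hR : 0 < R := by positivity
  -- A lower bound for `diam Q`: the distance from `x₀` to the boundary is at least `(D / 4) ^ s /
  -- CJ` and at most `5 * diam Q`.
  set m₀ := (D / 4) ^ s / (5 * CJ) with hm₀_def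
  have hm₀ : 0 < m₀ := by positivity
  set A₁ := M * (1 / 2) ^ (1 - n / p : ℝ) * (1 - (1 / 2) ^ e)⁻¹ * D ^ e with hA₁
  set A₂ := M * (9 / 8) * (7 / 8) ^ (-(n / p : ℝ)) * (3 ^ (α / p) * D ^ e +
        (9 / 8) ^ (1 - p⁻¹) * (((1 / 2) ^ s / (8 * CJ)) ^ (1 - n : ℝ) * 22 ^ n * 5 ^ α) ^ p⁻¹ *
        (L ^ e' * (1 - (1 / 2) ^ e')⁻¹)) with hA₂
  set A₃ := 2 * M * D * (m₀ / (8 * n)) ^ (-(n / p : ℝ)) * R ^ (α / p) with hA₃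
  -- `A₁`, `A₂`, `A₃` are the costs of the shrinking balls, the chain and the cube per unit of `δ ^
  -- (1 / p)`; hence the choice `δ = θ ^ p`.
  set θ := 1 / (|A₁| + |A₂| + |A₃| + 1) with hθ_def
  have hθ : 0 < θ := by positivity
  have hθ1 : A₁ * θ + A₂ * θ + A₃ * θ < 1 := by
    rw [← add_mul, ← add_mul, hθ_def, mul_one_div, div_lt_one (by positivity)]
    linarith [le_abs_self A₁, le_abs_self A₂, le_abs_self A₃]
  have hδθ : (θ ^ p) ^ (1 / p) = θ := by
    rw [one_div, Real.rpow_rpow_inv hθ.le hp0.ne']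
  refine ⟨θ ^ p, R, by positivity, hR, fun Ω x₀ hJ hdiam Q hQΩ hQ hx₀ hQ1 hQ2 u g hu hsob hu1 x
    hx hux => ?_⟩
  by_contra! hcon
  have hν := fun r hr hrR => (hcon r hr hrR).le
  set ν := (volume.restrict Ω).withDensity fun w => ‖g w‖ₑ ^ p with hν_def
  have h := hseg Ω u g hsob hJ.isOpen hu
  have hF := frontier_nonempty_of_isBounded (by lia) ⟨x₀, hJ.center_mem⟩ hJ.isBounded
  have hpos : ∀ y ∈ Ω, 0 < Metric.infDist y (frontier Ω) := fun y hy =>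
    infDist_frontier_pos hJ.isOpen hF hy
  have hdD : ∀ y ∈ Ω, Metric.infDist y (frontier Ω) ≤ D := fun y hy =>
    hdiam ▸ infDist_frontier_le_diam hJ.isBounded hF hy
  have h16 : (4 : ℝ) ≤ 16 * n := by linarith
  obtain ⟨hconv, hcomp, y₀, l, hl, hball, hl1, hl2⟩ := hQ.exists_center hn
  have hy₀ : y₀ ∈ Q := hball (Metric.mem_closedBall_self (by positivity))
  -- the averages over balls centered at `x`
  set r₀ := Metric.infDist x (frontier Ω) / 8 with hr₀_def
  have hr₀ : 0 < r₀ := div_pos (hpos x hx) (by norm_num)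
  have hr₀D : r₀ ≤ D := by have := hdD x hx; simp only [hr₀_def]; linarith
  have hballx : Metric.closedBall x r₀ ⊆ Ω :=
    closedBall_subset_of_lt_infDist_frontier hF hx (by have := hpos x hx; linarith)
  have h1 : smoothAverage u x r₀ ≤ A₁ * θ := by
    -- By continuity `u < η` near `x`, so the average over a sufficiently small ball is at most `η`;
    -- the bound from there back to radius `r₀` is independent of the number of halvings.
    refine le_of_forall_pos_le_add fun η hη => ?_
    have hcont := (hu x hx).continuousAt (hJ.isOpen.mem_nhds hx)
    obtain ⟨τ, hτ, hτu⟩ := Metric.nhds_basis_closedBall.eventually_iff.1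
      (hcont.eventually (gt_mem_nhds (show u x < η by linarith)))
    obtain ⟨k, hk⟩ := exists_pow_lt_of_lt_one (show 0 < τ / r₀ by positivity)
      (show (1 / 2 : ℝ) < 1 by norm_num)
    rw [lt_div_iff₀ hr₀, mul_comm] at hk
    have hle : r₀ * (1 / 2) ^ k ≤ r₀ :=
      mul_le_of_le_one_right hr₀.le (pow_le_one₀ (by norm_num) (by norm_num))
    have h2 := smoothAverage_le (u := u) (y := x) (r := r₀ * (1 / 2) ^ k) (b := η) (by positivity)
      (hu.mono ((Metric.closedBall_subset_closedBall hle).trans hballx))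
      fun w hw => (hτu (Metric.closedBall_subset_closedBall hk.le hw)).le
    have h3 := h.abs_sub_concentric_le hp (by linarith) hM.le (by positivity) hν he hr₀
      (by linarith) hballx k
    rw [hδθ] at h3
    have h4 : M * (1 / 2) ^ (1 - n / p : ℝ) * (1 - (1 / 2) ^ e)⁻¹ * r₀ ^ e * θ ≤ A₁ * θ := by
      have : ((1 : ℝ) / 2) ^ e < 1 := Real.rpow_lt_one (by norm_num) (by norm_num) he
      have : 0 ≤ (1 - ((1 : ℝ) / 2) ^ e)⁻¹ := inv_nonneg.2 (by linarith)
      simp only [hA₁]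
      gcongr
    linarith [(abs_le.1 h3).2]
  -- the averages along the curve
  obtain ⟨γ, hγ⟩ := hJ.exists_curve x hx
  obtain ⟨N, c, ℓ, hN, hc0, hcN, hc, hℓ0, hℓ, hJohn, hstep, hsep⟩ :=
    hγ.exists_chain hs hCJ.le hpos
  have h2 := h.abs_sub_chain_le (L := L) (D := D) hn hp hs0 hCJ (by positivity) h16 hM.le hν hF
    hpos he he' hL (by linarith) (by linarith) hdD hLs.ge hN hc0 hc hℓ0 hℓ hJohn hstep hsep
  rw [hδθ, hcN] at h2
  replace h2 : |smoothAverage u x r₀ - smoothAverage u x₀ (Metric.infDist x₀ (frontier Ω) / 8)| ≤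
    A₂ * θ := h2
  -- the averages along a segment in the central cube
  have hQD : Metric.diam Q ≤ D := hdiam ▸ Metric.diam_mono hQΩ hJ.isBounded
  have hmQ : m₀ ≤ Metric.diam Q := by
    have h3 := hJ.rpow_le hs0.le (hdiam ▸ hD)
    rw [hdiam] at h3
    have h4 := infDist_le_setDist_add_diam hcomp.isBounded hF hx₀
    rw [hm₀_def, div_le_iff₀ (by positivity)]
    have h5 : Metric.infDist x₀ (frontier Ω) ≤ 5 * Metric.diam Q := by linarith
    calc _ ≤ _ := h3
      _ ≤ CJ * (5 * Metric.diam Q) := by gcongr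
      _ = _ := by ring
  have hΩR : Ω ⊆ Metric.closedBall x R := fun y hy => by
    have := Metric.dist_le_diam_of_mem hJ.isBounded hy hx
    rw [hdiam] at this
    rw [Metric.mem_closedBall]; linarith
  have h3 := h.abs_sub_cube_le hn hp hM.le (by positivity) hν hR hΩR hF hQΩ hconv hcomp hQ1 hQ2
    hx₀ hy₀ hl hl1 hl2 hm₀ hmQ hQD
  rw [hδθ] at h3
  replace h3 : |smoothAverage u y₀ (l / 2) -
    smoothAverage u x₀ (Metric.infDist x₀ (frontier Ω) / 8)| ≤ A₃ * θ := h3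
  have h4 := one_le_smoothAverage (half_pos hl) (hu.mono (hball.trans hQΩ))
    fun w hw => hu1 w (hball hw)
  have h5 := (abs_le.1 h2).1
  have h6 := (abs_le.1 h3).2
  linarith

/-! ### Hausdorff content and coverings -/

/-- A finite cover is padded to a sequence by empty balls of radius 0, which cost nothing because `q
> 0`. -/
lemma hausdorffContent_le_sum {X : Type*} [PseudoMetricSpace X] [Nonempty X] {q : ℝ} (hq : 0 < q)
    {E : Set X} (t : Finset X) (r : X → ℝ≥0) (hE : E ⊆ ⋃ x ∈ t, Metric.ball x (r x)) :
    hausdorffContent q E ≤ ∑ x ∈ t, (r x : ℝ≥0∞) ^ q := by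
  classical
  set z : ℕ → X := fun k => if h : k < t.card then (t.equivFin.symm ⟨k, h⟩ : X)
    else Classical.arbitrary X with hz
  set ρ : ℕ → ℝ≥0 := fun k => if k < t.card then r (z k) else 0 with hρ
  refine (iInf₂_le z ρ).trans ((iInf_le _ ?_).trans (le_of_eq ?_))
  · intro y hy
    obtain ⟨x, hx, hyx⟩ := Set.mem_iUnion₂.1 (hE hy)
    refine Set.mem_iUnion.2 ⟨t.equivFin ⟨x, hx⟩, ?_⟩
    have hlt := (t.equivFin ⟨x, hx⟩).2
    have hzx : z (t.equivFin ⟨x, hx⟩) = x := by simp [hz]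
    simp only [hρ, hlt, if_true, hzx]
    exact hyx
  · rw [tsum_eq_sum (s := Finset.range t.card), Finset.sum_range, ← Finset.sum_coe_sort t]
    · refine Fintype.sum_equiv t.equivFin.symm _ _ fun k => ?_
      simp [hρ, hz]
    · intro k hk
      rw [Finset.mem_range] at hk
      simp [hρ, hk, hq]

lemma ENNReal.rpow_sum_le_sum_rpow {ι : Type*} (t : Finset ι) (f : ι → ℝ≥0∞) {β : ℝ} (h0 : 0 < β)
    (h1 : β ≤ 1) : (∑ i ∈ t, f i) ^ β ≤ ∑ i ∈ t, f i ^ β := by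
  classical
  induction t using Finset.induction_on with
  | empty => simp [h0]
  | insert a t ha ih =>
    rw [Finset.sum_insert ha, Finset.sum_insert ha]
    exact (ENNReal.rpow_add_le_add_rpow _ _ h0.le h1).trans (by gcongr)

/-- A set around every point of which some measure is large has controlled Hausdorff content. -/
lemma hausdorffContent_rpow_le_measure_univ {n : ℕ} {q α δ R : ℝ} (hα : 0 < α) (hq : α ≤ q)
    (hδ : 0 ≤ δ) {E : Set (EuclideanSpace ℝ (Fin n))} (hE : IsCompact E)
    (ν : Measure (EuclideanSpace ℝ (Fin n)))
    (h : ∀ x ∈ E, ∃ r, 0 < r ∧ r ≤ R ∧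
      ENNReal.ofReal (δ * r ^ α) ≤ ν (Metric.closedBall x r)) :
    ENNReal.ofReal (δ / 6 ^ α) * hausdorffContent q E ^ (α / q) ≤ ν Set.univ := by
  classical
  have hq0 : 0 < q := hα.trans_le hq
  have hex : ∀ x, ∃ r, x ∈ E → 0 < r ∧ r ≤ R ∧
      ENNReal.ofReal (δ * r ^ α) ≤ ν (Metric.closedBall x r) := fun x => by
    by_cases hx : x ∈ E
    · obtain ⟨r, hr⟩ := h x hx
      exact ⟨r, fun _ => hr⟩
    · exact ⟨0, fun h => absurd h hx⟩
  choose r hr using hex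
  obtain ⟨t, htE, htcover⟩ := hE.elim_nhds_subcover (fun x => Metric.closedBall x (r x))
    fun x hx => Metric.closedBall_mem_nhds x (hr x hx).1
  obtain ⟨v, hvt, hdisj, hcover⟩ := Vitali.exists_disjoint_subfamily_covering_enlargement_closedBall
    (t : Set (EuclideanSpace ℝ (Fin n))) (fun x => x) r R (fun x hx => (hr x (htE x hx)).2.1) 5
    (by norm_num)
  lift v to Finset (EuclideanSpace ℝ (Fin n)) using t.finite_toSet.subset hvt
  have hvr : ∀ x ∈ v, 0 < r x ∧ r x ≤ R ∧
      ENNReal.ofReal (δ * r x ^ α) ≤ ν (Metric.closedBall x (r x)) := fun x hx =>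
    hr x (htE x (hvt hx))
  -- Vitali gives closed balls enlarged 5 times; the factor 6 makes them open, and is undone by `6 ^
  -- α` in the constant.
  have hcontent : hausdorffContent q E ≤ ∑ x ∈ v, ENNReal.ofReal (6 * r x) ^ q := by
    refine hausdorffContent_le_sum hq0 v (fun x => (6 * r x).toNNReal) fun y hy => ?_
    obtain ⟨x, hx, hyx⟩ := Set.mem_iUnion₂.1 (htcover hy)
    obtain ⟨b, hb, hsub⟩ := hcover x hx
    refine Set.mem_iUnion₂.2 ⟨b, hb, ?_⟩
    have hb0 := (hvr b hb).1
    rw [Real.coe_toNNReal _ (by positivity)]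
    exact Metric.closedBall_subset_ball (by linarith) (hsub hyx)
  calc _ ≤ ENNReal.ofReal (δ / 6 ^ α) * (∑ x ∈ v, ENNReal.ofReal (6 * r x) ^ q) ^ (α / q) := by
        gcongr
    _ ≤ ENNReal.ofReal (δ / 6 ^ α) * ∑ x ∈ v, (ENNReal.ofReal (6 * r x) ^ q) ^ (α / q) := by
        gcongr
        exact ENNReal.rpow_sum_le_sum_rpow _ _ (by positivity) ((div_le_one hq0).2 hq)
    _ = ∑ x ∈ v, ENNReal.ofReal (δ * r x ^ α) := by
        rw [Finset.mul_sum]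
        refine Finset.sum_congr rfl fun x hx => ?_
        have hx0 := (hvr x hx).1
        rw [← ENNReal.rpow_mul, mul_div_cancel₀ _ hq0.ne',
          ENNReal.ofReal_rpow_of_pos (by positivity), ← ENNReal.ofReal_mul (by positivity),
          Real.mul_rpow (by norm_num) hx0.le]
        congr 1
        field_simp
    _ ≤ ∑ x ∈ v, ν (Metric.closedBall x (r x)) := Finset.sum_le_sum fun x hx => (hvr x hx).2.2
    _ = ν (⋃ x ∈ v, Metric.closedBall x (r x)) :=
        (measure_biUnion_finset hdisj fun _ _ => measurableSet_closedBall).symm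
    _ ≤ ν Set.univ := measure_mono (Set.subset_univ _)

/-! ### The capacity estimate -/

theorem theorem1p1 (n : ℕ) (hn : 2 ≤ n) (s p q ε : ℝ) (hs : 1 ≤ s) (hε0 : 0 < ε) (hε1 : ε < 1)
    (hp1 : 1 ≤ p) (hpn : p ≤ n) (hq : s * (n - 1) + 1 - p + ε ≤ q) (CJ D : ℝ) :
    ∃ C : ℝ, 0 < C ∧
      ∀ (Ω : Set (EuclideanSpace ℝ (Fin n))) (x₀ : EuclideanSpace ℝ (Fin n)),
        IsSJohnDomain s CJ Ω x₀ → Metric.diam Ω = D →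
        ∀ W : Set (Set (EuclideanSpace ℝ (Fin n))), IsWhitneyDecomposition Ω W →
        ∀ Q₀ ∈ W, x₀ ∈ Q₀ →
        ∀ E ⊆ Ω, IsCompact E → Disjoint E Q₀ →
          ENNReal.ofReal C * hausdorffContent q E ^ ((s * (n - 1) + 1 - p + ε) / q)
            ≤ pCapacity p E Q₀ Ω := by
  have hn2 : (2 : ℝ) ≤ n := by exact_mod_cast hn
  -- Since `s ≥ 1` and `p ≤ n`, the exponent is at least `n - p + ε`.
  have hα : 0 < s * (n - 1) + 1 - p + ε := by nlinarith
  by_cases hCD : 0 < CJ ∧ 0 < D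
  · obtain ⟨δ, R, hδ, hR, key⟩ := exists_energy_lower_bound (n := n) (by lia) hs hε0 hp1
      hCD.1 hCD.2
    refine ⟨δ / 6 ^ (s * (n - 1) + 1 - p + ε), by positivity,
      fun Ω x₀ hJ hdiam W hW Q₀ hQ₀ hx₀ E hEΩ hE _ => ?_⟩
    refine le_iInf fun u => le_iInf fun g => le_iInf fun ⟨hu, hsob, huE, huQ⟩ => ?_
    have hQΩ : Q₀ ⊆ Ω := hW.sUnion_eq ▸ Set.subset_sUnion_of_mem hQ₀
    have h1 := hausdorffContent_rpow_le_measure_univ hα hq hδ.le hE _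
      fun x hx => key Ω x₀ hJ hdiam Q₀ hQΩ (hW.isClosedCube _ hQ₀) hx₀ (hW.diam_le _ hQ₀)
        (hW.le_diam _ hQ₀) u g hu hsob huQ x (hEΩ hx) (huE x hx)
    rwa [withDensity_apply _ MeasurableSet.univ, Measure.restrict_univ] at h1
  -- No domain has these constants: a bounded nonempty open set has positive diameter, and then the
  -- John condition forces `CJ > 0`.
  · refine ⟨1, one_pos, fun Ω x₀ hJ hdiam => absurd ?_ hCD⟩
    have hF := frontier_nonempty_of_isBounded (by lia) ⟨x₀, hJ.center_mem⟩ hJ.isBounded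
    have hpos := infDist_frontier_pos hJ.isOpen hF hJ.center_mem
    have hD : 0 < Metric.diam Ω :=
      hpos.trans_le (infDist_frontier_le_diam hJ.isBounded hF hJ.center_mem)
    refine ⟨?_, hdiam ▸ hD⟩
    have h1 := hJ.rpow_le (by linarith) hD
    have h2 : 0 < (Metric.diam Ω / 4) ^ s := by positivity
    exact pos_of_mul_pos_left (h2.trans_le h1) hpos.le
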